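/- Conventions. $\mathbb Z_+=\{0,1,2,\dots\}$ and $\mathbb N=\{1,2,\dots\}$. A (Braun–Meise–Taylor) weight function is a continuous non-decreasing function $\omega:[0,\infty)\to[0,\infty)$ with $\omega=0$ on $[0,1]$, $\omega(2t)=O(\omega(t))$ and $\log t=o(\omega(t))$ as $t\to\infty$, and such that $\varphi_\omega(t)=\omega(e^t)$ is convex; put $\varphi^*_\omega(x)=\sup_{s\ge 0}(sx-\varphi_\omega(s))$. It is semiregular if $\omega(t)=o(t)$ as $t\to\infty$, and we call it subadditive up to an additive constant if there is $C$ with $\omega(s+t)\le\omega(s)+\omega(t)+C$ for all $s,t\ge0$ (that is, $\omega+C$ is subadditive). For $\Omega\subseteq\mathbb R^n$ open, $\mathcal E^{\{\omega\}}(\Omega)$ is the set of $f\in C^\infty(\Omega)$ (complex-valued) such that for every compact $K\subseteq\Omega$ there are $C,h>0$ with $\sup_K|\partial^\alpha f|\le C\exp\big(\tfrac1h\varphi_\omega^*(h|\alpha|)\big)$ for all $\alpha\in\mathbb Z_+^n$. For a family $\mathfrak M$ of sequences of positive numbers, $\mathcal E^{\{\mathfrak M\}}(\Omega)$ is the set of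 $f\in C^\infty(\Omega)$ such that for every compact $K\subseteq\Omega$ there are $M\in\mathfrak M$ and $C,h>0$ with $\sup_K|\partial^\alpha f|\le C h^{|\alpha|}M_{|\alpha|}$ for all $\alpha\in\mathbb Z_+^n$; for $\mathfrak M=\{M\}$ we write $\mathcal E^{\{M\}}(\Omega)$. The class $\mathcal E^{\{\omega\}}$ is quasianalytic if for all $n\ge1$ and all open $\Omega\subseteq\mathbb R^n$ the only compactly supported function in $\mathcal E^{\{\omega\}}(\Omega)$ is $0$. We write $\mathcal E^{\{\omega\}}\not\subseteq\mathcal E^{\{\mathfrak M\}}$ if $\mathcal E^{\{\omega\}}(\Omega)\not\subseteq\mathcal E^{\{\mathfrak M\}}(\Omega)$ for every non-empty open $\Omega\subseteq\mathbb R^n$ and every $n\ge1$. A semiregular weight sequence is a sequence $M=(M_k)_{k\ge0}$ of positive numbers with $M_0=1$, $M_k^{1/k}\to\infty$, $M_k^2\le M_{k-1}M_{k+1}$ for $k\ge1$, $M_k^{1/k}/k\to\infty$, and $M_{k+1}\le Q^{k+1}M_k$ for all $k\ge0$ and some $Q>0$. Theorem. (1) Let $\mathfrak M=\{M^{(\lambda)}:\lambda\in\mathbb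 N\}$ be a countable family of sequences $M^{(\lambda)}=(M^{(\lambda)}_k)_{k\ge0}$ of positive numbers such that $\sup_{k\ge1}(M_k^{(\lambda)})^{1/k}=\infty$ for every $\lambda$, and $M_k^{(\lambda_1)}\le M_k^{(\lambda_2)}$ for all $k\ge0$ and $\lambda_1\le\lambda_2$. Then there is a semiregular weight function $\omega$, subadditive up to an additive constant, such that $\mathcal E^{\{\omega\}}$ is quasianalytic and $\mathcal E^{\{\omega\}}\not\subseteq\mathcal E^{\{\mathfrak M\}}$. (2) There is a semiregular weight function $\omega$, subadditive up to an additive constant, such that $\mathcal E^{\{\omega\}}$ is quasianalytic and $\mathcal E^{\{\omega\}}\not\subseteq\mathcal E^{\{M\}}$ for every semiregular weight sequence $M$. -/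

import Mathlib

noncomputable section

namespace Ultradiff

/-- The mixed partial derivative `∂^α f (x)` of order `|α| = ∑ i, α i` of a function of `n` real
variables: the `|α|`-th derivative at `x`, evaluated on the tuple of standard basis vectors in which
the `i`-th one occurs `α i` times. -/
def mixedPartial {n : ℕ} (α : Fin n → ℕ) (f : EuclideanSpace ℝ (Fin n) → ℂ)
    (x : EuclideanSpace ℝ (Fin n)) : ℂ :=
  iteratedFDeriv ℝ (∑ i, α i) f x
    (fun j => EuclideanSpace.single (finSigmaFinEquiv.symm j).1 (1 : ℝ))

/-- A weight sequence: positive, normalized, logarithmically convex, with `M_k ^ (1/k) → ∞`. -/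
structure IsWeightSequence (M : ℕ → ℝ) : Prop where
  pos : ∀ k, 0 < M k
  zero : M 0 = 1
  root_tendsto : Filter.Tendsto (fun k : ℕ => M k ^ (1 / (k : ℝ))) Filter.atTop Filter.atTop
  logConvex : ∀ k, 1 ≤ k → M k ^ 2 ≤ M (k - 1) * M (k + 1)

/-- A semiregular weight sequence: `M_k ^ (1/k) / k → ∞` and `M_{k+1} ≤ Q^{k+1} M_k`. -/
structure IsSemiregularSequence (M : ℕ → ℝ) : Prop extends IsWeightSequence M where
  analytic_incl :
    Filter.Tendsto (fun k : ℕ => M k ^ (1 / (k : ℝ)) / (k : ℝ)) Filter.atTop Filter.atTop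
  deriv_closed : ∃ Q : ℝ, 0 < Q ∧ ∀ k, M (k + 1) ≤ Q ^ (k + 1) * M k

/-- A Braun–Meise–Taylor weight function `ω : [0,∞) → [0,∞)`; only the values of `ω` on `[0,∞)`
matter. -/
structure IsWeightFunction (ω : ℝ → ℝ) : Prop where
  continuousOn : ContinuousOn ω (Set.Ici 0)
  monotoneOn : MonotoneOn ω (Set.Ici 0)
  nonneg : ∀ t, 0 ≤ t → 0 ≤ ω t
  eq_zero : ∀ t ∈ Set.Icc (0 : ℝ) 1, ω t = 0
  doubling : (fun t => ω (2 * t)) =O[Filter.atTop] ω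
  log_isLittleO : Real.log =o[Filter.atTop] ω
  convex : ConvexOn ℝ Set.univ (fun t => ω (Real.exp t))

/-- A semiregular weight function: `ω(t) = o(t)`. -/
structure IsSemiregularFunction (ω : ℝ → ℝ) : Prop extends IsWeightFunction ω where
  isLittleO_id : ω =o[Filter.atTop] (fun t : ℝ => t)

/-- Subadditivity on `[0,∞)` up to an additive constant, that is, `ω + C` is subadditive for some
constant `C`. -/
def IsAlmostSubadditive (ω : ℝ → ℝ) : Prop :=
  ∃ C : ℝ, ∀ s t : ℝ, 0 ≤ s → 0 ≤ t → ω (s + t) ≤ ω s + ω t + C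

/-- The conjugate `φ*(x) = sup_{s ≥ 0} (s x - φ(s))` of `φ(s) = ω(e^s)`. For a weight function `ω`
the supremum is finite, since `log t = o(ω(t))`. -/
def conjugate (ω : ℝ → ℝ) (x : ℝ) : ℝ :=
  sSup ((fun s : ℝ => s * x - ω (Real.exp s)) '' Set.Ici 0)

/-- The Roumieu class on `Ω` given by a family `𝔐` of sequences: smooth functions `f` such that on
each compact `K ⊆ Ω` one has `|∂^α f| ≤ C h^|α| M_|α|` for some `M ∈ 𝔐` and `C, h > 0`. -/
def roumieuMatrix {n : ℕ} (𝔐 : Set (ℕ → ℝ)) (Ω : Set (EuclideanSpace ℝ (Fin n))) :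
    Set (EuclideanSpace ℝ (Fin n) → ℂ) :=
  {f | ContDiffOn ℝ ((⊤ : ℕ∞) : WithTop ℕ∞) f Ω ∧
    ∀ K : Set (EuclideanSpace ℝ (Fin n)), IsCompact K → K ⊆ Ω →
      ∃ M ∈ 𝔐, ∃ C h : ℝ, 0 < C ∧ 0 < h ∧
        ∀ (α : Fin n → ℕ), ∀ x ∈ K, ‖mixedPartial α f x‖ ≤ C * h ^ (∑ i, α i) * M (∑ i, α i)}

/-- The Roumieu class on `Ω` given by a single sequence (Denjoy–Carleman class). -/
def roumieuSequence {n : ℕ} (M : ℕ → ℝ) (Ω : Set (EuclideanSpace ℝ (Fin n))) :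
    Set (EuclideanSpace ℝ (Fin n) → ℂ) :=
  {f | ContDiffOn ℝ ((⊤ : ℕ∞) : WithTop ℕ∞) f Ω ∧
    ∀ K : Set (EuclideanSpace ℝ (Fin n)), IsCompact K → K ⊆ Ω →
      ∃ C h : ℝ, 0 < C ∧ 0 < h ∧
        ∀ (α : Fin n → ℕ), ∀ x ∈ K, ‖mixedPartial α f x‖ ≤ C * h ^ (∑ i, α i) * M (∑ i, α i)}

/-- The Roumieu class on `Ω` given by a weight function (Braun–Meise–Taylor class). -/
def roumieuFunction {n : ℕ} (ω : ℝ → ℝ) (Ω : Set (EuclideanSpace ℝ (Fin n))) :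
    Set (EuclideanSpace ℝ (Fin n) → ℂ) :=
  {f | ContDiffOn ℝ ((⊤ : ℕ∞) : WithTop ℕ∞) f Ω ∧
    ∀ K : Set (EuclideanSpace ℝ (Fin n)), IsCompact K → K ⊆ Ω →
      ∃ C h : ℝ, 0 < C ∧ 0 < h ∧
        ∀ (α : Fin n → ℕ), ∀ x ∈ K,
          ‖mixedPartial α f x‖ ≤ C * Real.exp (1 / h * conjugate ω (h * ((∑ i, α i : ℕ) : ℝ)))}

/-- A class of functions on `Ω` is quasianalytic if its only member that vanishes on `Ω` outside
some compact subset of `Ω` is the zero function on `Ω`. -/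
def IsQuasianalyticOn {n : ℕ} (𝓔 : Set (EuclideanSpace ℝ (Fin n) → ℂ))
    (Ω : Set (EuclideanSpace ℝ (Fin n))) : Prop :=
  ∀ f ∈ 𝓔, ∀ K : Set (EuclideanSpace ℝ (Fin n)), IsCompact K → K ⊆ Ω →
    (∀ x ∈ Ω \ K, f x = 0) → ∀ x ∈ Ω, f x = 0

end Ultradiff

end

/-! The weight is a sum of blocks `logBlock (m k)` with `m k` growing very fast. A block is
comparable to `t / m` up to `t = 2 ^ m`, so it adds an amount bounded below to `∫ ω(t) / t ^ 2 dt`,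
however large `m` is. Infinitely many blocks make this integral diverge, which is quasianalyticity;
beyond `2 ^ m` a block is only logarithmic, which leaves room for long stretches where `ω` is small.

Quasianalyticity: on a line, the derivative bounds make the Fourier transform of a compactly
supported member decay like `exp (-ω / h)`, up to a linear factor
(`norm_fourier_le_exp_neg_weight`). Its Laplace transform, damped by an exponential, is then killed
by explicit outer functions in the right half-plane: each block gains a fixed factor at a given
interior point (`le_re_outerLog`), while the boundary bound stays uniform
(`eq_zero_of_norm_le_exp_neg_logWeight`).

Non-inclusion: the scales `T k` lie between blocks `k` and `k + 1`. There `ω (T k) ≤ b * log (1 + T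
k) + 2`, with `b` fixed before `T k` is chosen (`logWeight_le_of_interlaced`). A lacunary
exponential series with frequencies `T k` (`exists_mem_roumieuFunction`) has a derivative of order
`b + 1` at least a constant times `T k`, and `T k` may be taken as large as needed to beat the
`k`-th sequence. The second assertion follows from the family `(l + 1) ^ k ^ 2`, which dominates all
semiregular sequences (`exists_le_pow_sq`). -/

open Filter Topology Asymptotics MeasureTheory

namespace Ultradiff

/-! ### Logarithmic blocks -/

/-- A function of `t ≥ 0` that behaves like `t / m` for `t ≤ 2 ^ m` and grows logarithmically
afterwards. -/
noncomputable def logBlock (m : ℕ) (t : ℝ) : ℝ := 2 ^ m / m * Real.log (1 + t / 2 ^ m)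

lemma one_le_one_add_div_two_pow (m : ℕ) {t : ℝ} (ht : 0 ≤ t) : 1 ≤ 1 + t / 2 ^ m := by
  have : 0 ≤ t / 2 ^ m := by positivity
  linarith

lemma logBlock_nonneg (m : ℕ) {t : ℝ} (ht : 0 ≤ t) : 0 ≤ logBlock m t :=
  mul_nonneg (by positivity) (Real.log_nonneg (one_le_one_add_div_two_pow m ht))

lemma logBlock_mono (m : ℕ) {s t : ℝ} (hs : 0 ≤ s) (hst : s ≤ t) :
    logBlock m s ≤ logBlock m t := by
  unfold logBlock
  have := one_le_one_add_div_two_pow m hs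
  gcongr

lemma logBlock_le_div (m : ℕ) {t : ℝ} (ht : 0 ≤ t) : logBlock m t ≤ t / m := by
  have h := Real.log_le_sub_one_of_pos
    (lt_of_lt_of_le one_pos (one_le_one_add_div_two_pow m ht))
  calc logBlock m t ≤ 2 ^ m / m * (t / 2 ^ m) := by
        unfold logBlock; gcongr; linarith
    _ = t / m := by field_simp

lemma logBlock_le_log (m : ℕ) {t : ℝ} (ht : 0 ≤ t) :
    logBlock m t ≤ 2 ^ m * Real.log (1 + t) := by
  have h1 : (1 : ℝ) ≤ 2 ^ m := one_le_pow₀ (by norm_num)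
  have h2 : t / 2 ^ m ≤ t := div_le_self ht h1
  have h3 := one_le_one_add_div_two_pow m ht
  have h4 : (2 : ℝ) ^ m / m ≤ 2 ^ m := by
    rcases Nat.eq_zero_or_pos m with rfl | hm
    · simp
    · exact div_le_self (by positivity) (by exact_mod_cast hm)
  unfold logBlock
  have h5 : 0 ≤ Real.log (1 + t / 2 ^ m) := Real.log_nonneg h3
  gcongr

lemma logBlock_add_le (m : ℕ) {s t : ℝ} (hs : 0 ≤ s) (ht : 0 ≤ t) :
    logBlock m (s + t) ≤ logBlock m s + logBlock m t := by
  unfold logBlock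
  have h1 := one_le_one_add_div_two_pow m hs
  have h2 := one_le_one_add_div_two_pow m ht
  rw [← mul_add, ← Real.log_mul (by positivity) (by positivity)]
  have h3 : 0 ≤ s / 2 ^ m := by positivity
  have h4 : 0 ≤ t / 2 ^ m := by positivity
  have h5 : 1 + (s + t) / 2 ^ m ≤ (1 + s / 2 ^ m) * (1 + t / 2 ^ m) := by
    rw [add_div]; nlinarith [mul_nonneg h3 h4]
  have h6 := one_le_one_add_div_two_pow m (add_nonneg hs ht)
  gcongr

lemma convexOn_log_one_add_exp {a : ℝ} (ha : 0 < a) :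
    ConvexOn ℝ Set.univ (fun s : ℝ => Real.log (1 + Real.exp s / a)) := by
  have hd : ∀ s : ℝ, HasDerivAt (fun s : ℝ => Real.log (1 + Real.exp s / a))
      (1 - a / (a + Real.exp s)) s := by
    intro s
    have hpos : 0 < 1 + Real.exp s / a := by positivity
    have := (((Real.hasDerivAt_exp s).div_const a).const_add 1).log hpos.ne'
    convert this using 1
    field_simp
    ring
  refine MonotoneOn.convexOn_of_deriv convex_univ
    (fun s _ => (hd s).continuousAt.continuousWithinAt)
    (fun s _ => (hd s).differentiableAt.differentiableWithinAt) ?_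
  intro s _ t _ hst
  rw [(hd s).deriv, (hd t).deriv]
  have := Real.exp_le_exp.2 hst
  have hp := Real.exp_pos s
  gcongr

lemma logBlock_convex (m : ℕ) : ConvexOn ℝ Set.univ (fun s => logBlock m (Real.exp s)) :=
  (convexOn_log_one_add_exp (by positivity : (0 : ℝ) < 2 ^ m)).smul
    (by positivity : (0 : ℝ) ≤ 2 ^ m / m)

/-- The base on the right is `1 + q` with `q = v ^ 2 / (4 * (1 + v))`, and the binomial terms up to
`q ^ 2` already suffice. The exponent 8 is what the dyadic induction in `sum_log_le_logBlock`
requires. -/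
lemma one_add_sq_le (v : ℝ) (hv : 0 ≤ v) :
    1 + v ^ 2 ≤ ((1 + v / 2) ^ 2 / (1 + v)) ^ 8 := by
  have h0 : (1 + v / 2) ^ 2 / (1 + v) = 1 + v ^ 2 / (4 * (1 + v)) := by field_simp; ring
  set q := v ^ 2 / (4 * (1 + v)) with hq
  have hq0 : 0 ≤ q := by positivity
  have hq1 : v ^ 2 = 4 * (1 + v) * q := by rw [hq]; field_simp
  rw [h0]
  have h1 : 1 + 8 * q + 28 * q ^ 2 ≤ (1 + q) ^ 8 := by
    have : (1 + q) ^ 8 = 1 + 8 * q + 28 * q ^ 2 + (56 * q ^ 3 + 70 * q ^ 4 + 56 * q ^ 5 + 28 * q ^ 6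
      + 8 * q ^ 7 + q ^ 8) := by ring
    rw [this]
    have : 0 ≤ 56 * q ^ 3 + 70 * q ^ 4 + 56 * q ^ 5 + 28 * q ^ 6 + 8 * q ^ 7 + q ^ 8 := by
      positivity
    linarith
  refine le_trans ?_ h1
  have h2 : 4 * (1 + v) ≤ 8 + 28 * q := by
    rw [hq]
    have : 8 + 28 * (v ^ 2 / (4 * (1 + v))) = (8 * (1 + v) + 7 * v ^ 2) / (1 + v) := by
      field_simp; ring
    rw [this, le_div_iff₀ (by positivity)]
    nlinarith
  nlinarith [mul_le_mul_of_nonneg_right h2 hq0]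

/-- The harmonic minorant of `4 m logBlock m` on the imaginary axis. -/
lemma sum_log_le_logBlock {m : ℕ} (hm : 1 ≤ m) {t : ℝ} (ht : 0 ≤ t) :
    ∑ j ∈ Finset.range m, (2 : ℝ) ^ j * (1 / 2 * Real.log (1 + (t / 2 ^ j) ^ 2)) ≤
      4 * m * logBlock m t := by
  have hm0 : (m : ℝ) ≠ 0 := by positivity
  -- Without the factor `1 / m` the bound telescopes: going from `N` to `N + 1` raises the right
  -- side by `4 * 2 ^ N * (2 * log (1 + v / 2) - log (1 + v))`, where `v = t / 2 ^ N`.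
  have key : ∀ N : ℕ,
      ∑ j ∈ Finset.range N, (2 : ℝ) ^ j * (1 / 2 * Real.log (1 + (t / 2 ^ j) ^ 2)) ≤
        4 * (2 ^ N * Real.log (1 + t / 2 ^ N)) := by
    intro N
    induction N with
    | zero =>
      have := Real.log_nonneg (one_le_one_add_div_two_pow 0 ht)
      simp only [Finset.range_zero, Finset.sum_empty]
      positivity
    | succ N ih =>
      rw [Finset.sum_range_succ]
      set v := t / 2 ^ N with hv
      have hv0 : 0 ≤ v := by positivity
      have hv2 : t / 2 ^ (N + 1) = v / 2 := by rw [hv, pow_succ]; field_simp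
      have h1 : Real.log (1 + v ^ 2) ≤ 8 * (2 * Real.log (1 + v / 2) - Real.log (1 + v)) := by
        have := Real.log_le_log (by positivity) (one_add_sq_le v hv0)
        rw [Real.log_pow, Real.log_div (by positivity) (by positivity), Real.log_pow] at this
        exact_mod_cast this
      have h2 : (0 : ℝ) < 2 ^ N := by positivity
      rw [hv2, pow_succ (2 : ℝ) N]
      nlinarith [mul_le_mul_of_nonneg_left h1 h2.le]
  refine (key m).trans (le_of_eq ?_)
  unfold logBlock
  field_simp

/-! ### Superposition of blocks and its truncation -/

/-- A superposition of logarithmic blocks. -/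
noncomputable def logWeight (m : ℕ → ℕ) (t : ℝ) : ℝ := ∑' k, logBlock (m k) t

section

variable {m : ℕ → ℕ}

lemma logBlock_le_geometric (hm : ∀ k, 2 ^ k ≤ m k) {t : ℝ} (ht : 0 ≤ t) (k : ℕ) :
    logBlock (m k) t ≤ t * (1 / 2) ^ k := by
  refine (logBlock_le_div _ ht).trans ?_
  have h : (2 : ℝ) ^ k ≤ m k := by exact_mod_cast hm k
  rw [one_div, inv_pow, ← div_eq_mul_inv]
  gcongr

lemma summable_logBlock (hm : ∀ k, 2 ^ k ≤ m k) {t : ℝ} (ht : 0 ≤ t) :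
    Summable (fun k => logBlock (m k) t) :=
  Summable.of_nonneg_of_le (fun _ => logBlock_nonneg _ ht) (logBlock_le_geometric hm ht)
    (summable_geometric_two.mul_left t)

lemma logWeight_nonneg (m : ℕ → ℕ) {t : ℝ} (ht : 0 ≤ t) : 0 ≤ logWeight m t :=
  tsum_nonneg fun _ => logBlock_nonneg _ ht

lemma logWeight_mono (hm : ∀ k, 2 ^ k ≤ m k) {s t : ℝ} (hs : 0 ≤ s) (hst : s ≤ t) :
    logWeight m s ≤ logWeight m t :=
  (summable_logBlock hm hs).tsum_le_tsum (fun _ => logBlock_mono _ hs hst)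
    (summable_logBlock hm (hs.trans hst))

lemma logWeight_add_le (hm : ∀ k, 2 ^ k ≤ m k) {s t : ℝ} (hs : 0 ≤ s) (ht : 0 ≤ t) :
    logWeight m (s + t) ≤ logWeight m s + logWeight m t := by
  unfold logWeight
  rw [← (summable_logBlock hm hs).tsum_add (summable_logBlock hm ht)]
  exact (summable_logBlock hm (add_nonneg hs ht)).tsum_le_tsum (fun _ => logBlock_add_le _ hs ht)
    ((summable_logBlock hm hs).add (summable_logBlock hm ht))

lemma logWeight_convex (hm : ∀ k, 2 ^ k ≤ m k) :
    ConvexOn ℝ Set.univ (fun s => logWeight m (Real.exp s)) := by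
  refine ⟨convex_univ, fun x _ y _ a b ha hb hab => ?_⟩
  have hx := summable_logBlock hm (Real.exp_pos x).le
  have hy := summable_logBlock hm (Real.exp_pos y).le
  have := (summable_logBlock hm (Real.exp_pos (a • x + b • y)).le).tsum_le_tsum
    (fun k => (logBlock_convex (m k)).2 (Set.mem_univ x) (Set.mem_univ y) ha hb hab)
    ((hx.mul_left a).add (hy.mul_left b))
  simp only [smul_eq_mul] at this ⊢
  rw [(hx.mul_left a).tsum_add (hy.mul_left b), tsum_mul_left, tsum_mul_left] at this
  exact this

lemma sum_logBlock_le_logWeight (hm : ∀ k, 2 ^ k ≤ m k) {t : ℝ} (ht : 0 ≤ t) (N : ℕ) :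
    ∑ k ∈ Finset.range N, logBlock (m k) t ≤ logWeight m t :=
  (summable_logBlock hm ht).sum_le_tsum _ (fun _ _ => logBlock_nonneg _ ht)

lemma isLittleO_log_one_add_div {a : ℝ} (ha : 0 < a) :
    Tendsto (fun t : ℝ => Real.log (1 + t / a) / t) atTop (𝓝 0) := by
  have h1 : Tendsto (fun t : ℝ => 1 + t / a) atTop atTop :=
    tendsto_atTop_add_const_left _ _ (tendsto_id.atTop_div_const ha)
  have h2 : (fun t : ℝ => Real.log (1 + t / a)) =o[atTop] (fun t => 1 + t / a) :=
    Real.isLittleO_log_id_atTop.comp_tendsto h1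
  have h3 : (fun t : ℝ => 1 + t / a) =O[atTop] (fun t : ℝ => t) := by
    refine IsBigO.add ?_ ?_
    · exact (isLittleO_const_id_atTop (1 : ℝ)).isBigO
    · simp_rw [div_eq_inv_mul]
      exact (isBigO_refl _ _).const_mul_left _
  exact (h2.trans_isBigO h3).tendsto_div_nhds_zero

/-- Dominated convergence: each block is logarithmic at infinity, and the quotients by `t` are
bounded by `(1 / 2) ^ k` uniformly in `t`. -/
lemma logWeight_isLittleO (hm : ∀ k, 2 ^ k ≤ m k) :
    logWeight m =o[atTop] (fun t : ℝ => t) := by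
  refine isLittleO_of_tendsto' ?_ ?_
  · filter_upwards [eventually_gt_atTop 0] with t ht h
    exact absurd h ht.ne'
  have h := tendsto_tsum_of_dominated_convergence (𝓕 := atTop)
    (f := fun (t : ℝ) k => logBlock (m k) t / t) (g := fun _ : ℕ => (0 : ℝ))
    (bound := fun k => (1 / 2 : ℝ) ^ k) summable_geometric_two ?_ ?_
  · simp only [tsum_zero, tsum_div_const] at h
    exact h
  · intro k
    have := (isLittleO_log_one_add_div (by positivity : (0 : ℝ) < 2 ^ m k)).const_mul
      (2 ^ m k / m k : ℝ)
    simpa [logBlock, mul_div_assoc] using this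
  · filter_upwards [eventually_gt_atTop 0] with t ht k
    rw [Real.norm_of_nonneg (div_nonneg (logBlock_nonneg _ ht.le) ht.le), div_le_iff₀ ht, mul_comm]
    exact logBlock_le_geometric hm ht.le k

lemma log_sub_le_logBlock {n : ℕ} (hn : 1 ≤ n) {t : ℝ} (ht : 1 ≤ t) :
    Real.log t - n ≤ logBlock n t := by
  have h1 : (1 : ℝ) ≤ 2 ^ n / n := by
    rw [le_div_iff₀ (by positivity), one_mul]
    exact_mod_cast Nat.lt_two_pow_self.le
  have h2 : 0 ≤ Real.log (1 + t / 2 ^ n) :=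
    Real.log_nonneg (one_le_one_add_div_two_pow n (by linarith))
  have h3 : Real.log t - n ≤ Real.log (1 + t / 2 ^ n) := by
    have : Real.log (t / 2 ^ n) ≤ Real.log (1 + t / 2 ^ n) :=
      Real.log_le_log (by positivity) (by linarith)
    rw [Real.log_div (by positivity) (by positivity), Real.log_pow] at this
    have h4 : (n : ℝ) * Real.log 2 ≤ n * 1 := by
      gcongr; linarith [Real.log_two_lt_d9]
    linarith
  unfold logBlock
  nlinarith

lemma one_le_of_two_pow_le (hm : ∀ k, 2 ^ k ≤ m k) (k : ℕ) : 1 ≤ m k :=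
  Nat.one_le_two_pow.trans (hm k)

/-- The weight function obtained from `logWeight m` by truncation. -/
noncomputable def truncWeight (m : ℕ → ℕ) (t : ℝ) : ℝ := max 0 (logWeight m t - logWeight m 1)

lemma truncWeight_nonneg (m : ℕ → ℕ) (t : ℝ) : 0 ≤ truncWeight m t := le_max_left _ _

lemma truncWeight_le (m : ℕ → ℕ) {t : ℝ} (ht : 0 ≤ t) : truncWeight m t ≤ logWeight m t :=
  max_le (logWeight_nonneg m ht) (by linarith [logWeight_nonneg m zero_le_one])

lemma logWeight_le_truncWeight_add (m : ℕ → ℕ) (t : ℝ) :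
    logWeight m t ≤ truncWeight m t + logWeight m 1 := by
  unfold truncWeight
  linarith [le_max_right 0 (logWeight m t - logWeight m 1)]

lemma truncWeight_isAlmostSubadditive (hm : ∀ k, 2 ^ k ≤ m k) :
    IsAlmostSubadditive (truncWeight m) := by
  refine ⟨2 * logWeight m 1, fun s t hs ht => ?_⟩
  linarith [truncWeight_le m (add_nonneg hs ht), logWeight_add_le hm hs ht,
    logWeight_le_truncWeight_add m s, logWeight_le_truncWeight_add m t]

lemma truncWeight_convex (hm : ∀ k, 2 ^ k ≤ m k) :
    ConvexOn ℝ Set.univ (fun s => truncWeight m (Real.exp s)) := by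
  have h1 := (logWeight_convex hm).add_const (-logWeight m 1)
  exact (convexOn_const 0 convex_univ).sup h1

lemma truncWeight_eq_zero (hm : ∀ k, 2 ^ k ≤ m k) {t : ℝ} (ht : t ∈ Set.Icc (0 : ℝ) 1) :
    truncWeight m t = 0 :=
  max_eq_left (by linarith [logWeight_mono hm ht.1 ht.2])

/-- Convexity in the variable `log t` gives continuity for `t > 0`; near `0` the function vanishes.
-/
lemma truncWeight_continuousOn (hm : ∀ k, 2 ^ k ≤ m k) :
    ContinuousOn (truncWeight m) (Set.Ici 0) := by
  have hc : Continuous (fun s => truncWeight m (Real.exp s)) :=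
    continuousOn_univ.1 ((truncWeight_convex hm).continuousOn isOpen_univ)
  intro t ht
  rcases eq_or_lt_of_le (show (0 : ℝ) ≤ t from ht) with rfl | h0
  · have h : (fun _ => (0 : ℝ)) =ᶠ[𝓝[Set.Ici 0] (0 : ℝ)] truncWeight m := by
      filter_upwards [self_mem_nhdsWithin, mem_nhdsWithin_of_mem_nhds (Iio_mem_nhds one_pos)]
        with x hx hx1
      exact (truncWeight_eq_zero hm ⟨hx, le_of_lt hx1⟩).symm
    refine (continuousWithinAt_const (b := (0 : ℝ))).congr_of_eventuallyEq h.symm ?_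
    exact truncWeight_eq_zero hm ⟨le_rfl, zero_le_one⟩
  · have h : (fun x => truncWeight m (Real.exp (Real.log x))) =ᶠ[𝓝 t] truncWeight m := by
      filter_upwards [Ioi_mem_nhds h0] with x hx
      rw [Real.exp_log hx]
    have : ContinuousAt (fun x => truncWeight m (Real.exp (Real.log x))) t :=
      hc.continuousAt.comp (Real.continuousAt_log h0.ne')
    exact (this.congr h).continuousWithinAt

lemma truncWeight_log_isLittleO (hm : ∀ k, 2 ^ k ≤ m k) :
    Real.log =o[atTop] truncWeight m := by
  refine isLittleO_iff_nat_mul_le.2 fun N => ?_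
  -- The first `N + 1` blocks give `(N + 1) * log t` with total loss `D`, truncation included; the
  -- extra logarithm absorbs `D`.
  set D : ℝ := ∑ k ∈ Finset.range (N + 1), (m k : ℝ) + logWeight m 1 with hD
  filter_upwards [eventually_ge_atTop 1, Real.tendsto_log_atTop.eventually_ge_atTop D] with t ht hD'
  rw [Real.norm_of_nonneg (Real.log_nonneg ht), Real.norm_of_nonneg (truncWeight_nonneg m t)]
  have h1 : ∑ k ∈ Finset.range (N + 1), (Real.log t - m k) ≤ logWeight m t :=
    (Finset.sum_le_sum fun k _ => log_sub_le_logBlock (one_le_of_two_pow_le hm k) ht).trans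
      (sum_logBlock_le_logWeight hm (by linarith) _)
  rw [Finset.sum_sub_distrib] at h1
  simp only [Finset.sum_const, Finset.card_range, nsmul_eq_mul] at h1
  push_cast at h1
  linarith [logWeight_le_truncWeight_add m t]

lemma truncWeight_isSemiregularFunction (hm : ∀ k, 2 ^ k ≤ m k) :
    IsSemiregularFunction (truncWeight m) where
  continuousOn := truncWeight_continuousOn hm
  monotoneOn := fun _ hs _ _ hst =>
    max_le_max le_rfl (sub_le_sub_right (logWeight_mono hm hs hst) _)
  nonneg := fun t _ => truncWeight_nonneg m t
  eq_zero := fun _ ht => truncWeight_eq_zero hm ht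
  doubling := by
    obtain ⟨C, hC⟩ := truncWeight_isAlmostSubadditive hm
    have hlog := isLittleO_iff_nat_mul_le.1 (truncWeight_log_isLittleO hm) 1
    -- Subadditivity gives `2 * ω t + C`, and eventually `C ≤ log t ≤ ω t`.
    refine IsBigO.of_bound 3 ?_
    filter_upwards [eventually_ge_atTop 1, hlog, Real.tendsto_log_atTop.eventually_ge_atTop C]
      with t ht h1 h2
    rw [Real.norm_of_nonneg (Real.log_nonneg ht),
      Real.norm_of_nonneg (truncWeight_nonneg m t)] at h1
    rw [Real.norm_of_nonneg (truncWeight_nonneg m _), Real.norm_of_nonneg (truncWeight_nonneg m t),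
      two_mul]
    have := hC t t (by linarith) (by linarith)
    push_cast at h1
    linarith
  log_isLittleO := truncWeight_log_isLittleO hm
  convex := truncWeight_convex hm
  isLittleO_id := by
    refine IsBigO.trans_isLittleO (IsBigO.of_bound 1 ?_) (logWeight_isLittleO hm)
    filter_upwards [eventually_ge_atTop 0] with t ht
    rw [Real.norm_of_nonneg (truncWeight_nonneg m t), Real.norm_of_nonneg (logWeight_nonneg m ht),
      one_mul]
    exact truncWeight_le m ht

end

/-! ### Fourier decay from derivative bounds -/

/-- The ideal real order is `c / h`, with `c` the slope of a supporting line of `s ↦ ω (exp s)` at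
`log t`; it would give `-ω t / h`. Rounding down to an integer costs at most `log t`, and taking an
affine minorant lying 1 below the graph at that point costs `1 / h`. -/
lemma IsWeightFunction.exists_conjugate_le {ω : ℝ → ℝ} (hω : IsWeightFunction ω) {h : ℝ}
    (hh : 0 < h) {t : ℝ} (ht : 1 ≤ t) :
    ∃ j : ℕ, 1 / h * conjugate ω (h * j) - j * Real.log t ≤ Real.log t + (1 - ω t) / h := by
  have hs : 0 ≤ Real.log t := Real.log_nonneg ht
  have hes : Real.exp (Real.log t) = t := Real.exp_log (by linarith)
  obtain ⟨c, c', hle, heq⟩ := hω.convex.exists_affine_le_of_lt_real (x := Real.log t)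
    (a := ω (Real.exp (Real.log t)) - 1) (Set.mem_univ _) (by linarith) isClosed_univ
    (hω.convex.continuousOn isOpen_univ).lowerSemicontinuousOn
  rw [hes] at heq
  have hneg : ∀ u ≤ (0 : ℝ), c * u + c' ≤ 0 := fun u hu =>
    (hle u (Set.mem_univ u)).trans
      (hω.eq_zero _ ⟨(Real.exp_pos u).le, Real.exp_le_one_iff.2 hu⟩).le
  have hc'0 : c' ≤ 0 := by simpa using hneg 0 le_rfl
  -- A line of negative slope would be unbounded on the negative axis, where the convex function
  -- vanishes.
  have hc : 0 ≤ c := by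
    by_contra! hc
    have h1 := hneg ((1 - c') / c) (div_nonpos_of_nonneg_of_nonpos (by linarith) hc.le)
    rw [mul_div_cancel₀ _ hc.ne] at h1
    linarith
  refine ⟨⌊c / h⌋₊, ?_⟩
  set j := ⌊c / h⌋₊
  have hj1 : h * j ≤ c := by
    have := Nat.floor_le (div_nonneg hc hh.le)
    rw [le_div_iff₀ hh] at this
    linarith
  have hj2 : c < h * (j + 1) := by
    have := Nat.lt_floor_add_one (c / h)
    rw [div_lt_iff₀ hh] at this
    linarith
  have hconj : conjugate ω (h * j) ≤ -c' := by
    refine csSup_le (Set.nonempty_Ici.image _) ?_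
    rintro _ ⟨u, hu, rfl⟩
    have := hle u (Set.mem_univ u)
    have h3 := mul_le_mul_of_nonneg_left hj1 (show (0 : ℝ) ≤ u from hu)
    simp only
    linarith
  have h4 : h * (1 / h * conjugate ω (h * j) - j * Real.log t) ≤
      h * (Real.log t + (1 - ω t) / h) := by
    have e1 : h * (1 / h * conjugate ω (h * j) - j * Real.log t) =
      conjugate ω (h * j) - h * j * Real.log t := by field_simp
    have e2 : h * (Real.log t + (1 - ω t) / h) = h * Real.log t + (1 - ω t) := by field_simp
    rw [e1, e2]
    nlinarith [mul_le_mul_of_nonneg_right hj2.le hs]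
  exact le_of_mul_le_mul_left h4 hh

section Fourier

open FourierTransform

lemma integrable_iteratedDeriv {g : ℝ → ℂ} (hg : ContDiff ℝ ((⊤ : ℕ∞) : WithTop ℕ∞) g)
    (hc : HasCompactSupport g) (j : ℕ) : Integrable (iteratedDeriv j g) := by
  refine (hg.continuous_iteratedDeriv j (by exact_mod_cast le_top)).integrable_of_hasCompactSupport
    ?_
  refine (hc.iteratedFDeriv (𝕜 := ℝ) j).mono ?_
  intro x hx hx0
  apply hx
  rw [iteratedDeriv_eq_iteratedFDeriv, hx0]
  rfl

lemma norm_fourier_mul_pow_le {g : ℝ → ℂ} (hg : ContDiff ℝ ((⊤ : ℕ∞) : WithTop ℕ∞) g)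
    (hc : HasCompactSupport g) {j : ℕ} {B : ℝ} (hB : ∀ x, ‖iteratedDeriv j g x‖ ≤ B) (w : ℝ) :
    |2 * Real.pi * w| ^ j * ‖𝓕 g w‖ ≤ B * volume.real (tsupport g) := by
  have h1 := congrFun (Real.fourier_iteratedDeriv (n := j) (N := ⊤) hg
    (fun n _ => integrable_iteratedDeriv hg hc n) le_top) w
  have h2 : ‖𝓕 (iteratedDeriv j g) w‖ = |2 * Real.pi * w| ^ j * ‖𝓕 g w‖ := by
    rw [h1, norm_smul, norm_pow]
    congr 2
    simp [abs_mul]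
  rw [← h2]
  have h3 : ‖𝓕 (iteratedDeriv j g) w‖ ≤ ∫ v, ‖iteratedDeriv j g v‖ :=
    VectorFourier.norm_fourierIntegral_le_integral_norm _ _ _ _ _
  refine h3.trans ?_
  have h4 : ∀ x, x ∉ tsupport g → ‖iteratedDeriv j g x‖ = 0 := by
    intro x hx
    have : iteratedFDeriv ℝ j g x = 0 := by
      by_contra h
      exact hx (support_iteratedFDeriv_subset j h)
    rw [← norm_iteratedFDeriv_eq_norm_iteratedDeriv, this, norm_zero]
  rw [← setIntegral_eq_integral_of_forall_compl_eq_zero h4]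
  refine (le_abs_self _).trans ?_
  exact norm_setIntegral_le_of_norm_le_const (μ := volume) (f := fun x => ‖iteratedDeriv j g x‖)
    hc.isCompact.measure_lt_top (fun x _ => by simpa using hB x)

/-- For each frequency the best derivative order is used: order `0` when `t ≤ 1`, otherwise the one
from `exists_conjugate_le`, whose rounding loss is the linear factor. -/
lemma norm_fourier_le_exp_neg_weight {ω : ℝ → ℝ} (hω : IsWeightFunction ω) {g : ℝ → ℂ}
    (hg : ContDiff ℝ ((⊤ : ℕ∞) : WithTop ℕ∞) g) (hc : HasCompactSupport g) {C h : ℝ}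
    (hC : 0 < C) (hh : 0 < h)
    (hB : ∀ (j : ℕ) (x : ℝ), ‖iteratedDeriv j g x‖ ≤ C * Real.exp (1 / h * conjugate ω (h * j))) :
    ∃ A : ℝ, 0 ≤ A ∧ ∀ w : ℝ,
      ‖𝓕 g w‖ ≤ A * ((1 + |2 * Real.pi * w|) * Real.exp (-(ω |2 * Real.pi * w| / h))) := by
  set V := volume.real (tsupport g)
  have hV : 0 ≤ V := measureReal_nonneg
  set E := Real.exp (1 / h * conjugate ω (h * (0 : ℕ))) with hE
  refine ⟨C * V * (Real.exp (1 / h) + E), by positivity, fun w => ?_⟩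
  set t := |2 * Real.pi * w| with ht
  have ht0 : 0 ≤ t := abs_nonneg _
  rcases le_total t 1 with h1 | h1
  · rw [hω.eq_zero t ⟨ht0, h1⟩]
    have h2 := norm_fourier_mul_pow_le hg hc (hB 0) w
    rw [pow_zero, one_mul] at h2
    refine h2.trans ?_
    simp only [zero_div, neg_zero, Real.exp_zero, mul_one]
    have : C * E * V ≤ C * V * (Real.exp (1 / h) + E) * 1 := by
      nlinarith [mul_nonneg (mul_nonneg hC.le hV) (Real.exp_pos (1 / h)).le]
    refine this.trans ?_
    gcongr
    linarith
  · obtain ⟨j, hj⟩ := hω.exists_conjugate_le hh h1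
    have h2 := norm_fourier_mul_pow_le hg hc (hB j) w
    have htp : 0 < t := by linarith
    rw [← ht, ← le_div_iff₀' (by positivity)] at h2
    refine h2.trans ?_
    have h3 : Real.exp (1 / h * conjugate ω (h * j)) / t ^ j ≤
        t * (Real.exp (1 / h) * Real.exp (-(ω t / h))) := by
      have e1 : t ^ j = Real.exp (j * Real.log t) := by
        rw [← Real.log_pow, Real.exp_log (by positivity)]
      rw [e1, ← Real.exp_sub, ← Real.exp_add]
      nth_rewrite 2 [← Real.exp_log htp]
      rw [← Real.exp_add]
      refine Real.exp_le_exp.2 (hj.trans (le_of_eq ?_))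
      ring
    calc C * Real.exp (1 / h * conjugate ω (h * j)) * V / t ^ j
        = C * V * (Real.exp (1 / h * conjugate ω (h * j)) / t ^ j) := by ring
      _ ≤ C * V * (t * (Real.exp (1 / h) * Real.exp (-(ω t / h)))) := by gcongr
      _ = C * V * Real.exp (1 / h) * (t * Real.exp (-(ω t / h))) := by ring
      _ ≤ C * V * (Real.exp (1 / h) + E) * ((1 + t) * Real.exp (-(ω t / h))) := by
        gcongr
        · linarith [Real.exp_pos (1 / h * conjugate ω (h * (0 : ℕ)))]
        · linarith

end Fourier

/-! ### The Laplace transform of a compactly supported function -/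

section Laplace

lemma differentiable_laplace {g : ℝ → ℂ} (hg : Continuous g) (hc : HasCompactSupport g) :
    Differentiable ℂ (fun z : ℂ => ∫ t : ℝ, g t * Complex.exp (-(z * t))) := by
  intro z₀
  obtain ⟨R, hR⟩ := hc.isCompact.isBounded.exists_norm_le
  have hcont : ∀ z : ℂ, Continuous fun t : ℝ => g t * Complex.exp (-(z * t)) := fun z => by
    fun_prop
  have hint : ∀ f : ℝ → ℂ, Continuous f → Integrable fun t => g t * f t := fun f hf =>
    (hg.mul hf).integrable_of_hasCompactSupport hc.mul_right
  refine (hasDerivAt_integral_of_dominated_loc_of_deriv_le (μ := volume)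
    (F := fun (z : ℂ) (t : ℝ) => g t * Complex.exp (-(z * t)))
    (F' := fun (z : ℂ) (t : ℝ) => g t * (Complex.exp (-(z * t)) * -t)) (x₀ := z₀)
    (s := Metric.ball z₀ 1) (bound := fun t => ‖g t‖ * (Real.exp ((‖z₀‖ + 1) * |t|) * |t|))
    (Metric.ball_mem_nhds _ one_pos)
    (Eventually.of_forall fun z => (hcont z).aestronglyMeasurable) (hint _ (by fun_prop))
    (by fun_prop) (Eventually.of_forall fun t z hz => ?_) ?_
    (Eventually.of_forall fun t z _ => ?_)).2.differentiableAt
  · rw [norm_mul, norm_mul, Complex.norm_exp, norm_neg, Complex.norm_real, Real.norm_eq_abs]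
    gcongr
    refine (Complex.re_le_norm _).trans ?_
    rw [norm_neg, norm_mul, Complex.norm_real, Real.norm_eq_abs]
    gcongr
    have := norm_sub_norm_le z z₀
    rw [Metric.mem_ball, dist_eq_norm] at hz
    linarith
  · exact (hg.norm.mul (by fun_prop)).integrable_of_hasCompactSupport hc.norm.mul_right
  · have := ((hasDerivAt_id z).mul_const (t : ℂ)).neg.cexp.const_mul (g t)
    simpa using this

lemma exists_norm_laplace_le {g : ℝ → ℂ} (hg : Continuous g) (hc : HasCompactSupport g) :
    ∃ a A : ℝ, 0 ≤ A ∧ ∀ z : ℂ, 0 ≤ z.re →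
      ‖∫ t : ℝ, g t * Complex.exp (-(z * t))‖ ≤ A * Real.exp (a * z.re) := by
  obtain ⟨R, hR⟩ := hc.isCompact.isBounded.exists_norm_le
  refine ⟨R, ∫ t, ‖g t‖, integral_nonneg fun _ => norm_nonneg _, fun z hz => ?_⟩
  rw [← integral_mul_const]
  refine norm_integral_le_of_norm_le
    ((hg.integrable_of_hasCompactSupport hc).norm.mul_const _) (Eventually.of_forall fun t => ?_)
  rw [norm_mul]
  by_cases ht : t ∈ tsupport g
  · gcongr
    rw [Complex.norm_exp, Real.exp_le_exp]
    have := (neg_le_abs t).trans (hR t ht)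
    simp only [Complex.neg_re, Complex.mul_re, Complex.ofReal_re, Complex.ofReal_im, mul_zero,
      sub_zero]
    nlinarith
  · simp [image_eq_zero_of_notMem_tsupport ht]

end Laplace

/-! ### A uniqueness theorem in the right half-plane -/

section HalfPlane

/-- The logarithm of an outer function on the right half-plane, of modulus at most
`exp (b * logWeight m |x|) / |1 + i x|` at the boundary point `i x`. -/
noncomputable def outerLog (m : ℕ → ℕ) (b : ℝ) (N : ℕ) (z : ℂ) : ℂ :=
  ∑ k ∈ Finset.range N, ∑ j ∈ Finset.range (m k),
    ((b / (4 * m k) * 2 ^ j : ℝ) : ℂ) * Complex.log (1 + z / ((2 ^ j : ℝ) : ℂ)) -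
    Complex.log (1 + z)

lemma re_outerLog (m : ℕ → ℕ) (b : ℝ) (N : ℕ) (z : ℂ) :
    (outerLog m b N z).re = ∑ k ∈ Finset.range N, ∑ j ∈ Finset.range (m k),
      b / (4 * m k) * 2 ^ j * Real.log ‖1 + z / ((2 ^ j : ℝ) : ℂ)‖ - Real.log ‖1 + z‖ := by
  simp only [outerLog, Complex.sub_re, Complex.re_sum, Complex.re_ofReal_mul, Complex.log_re]

lemma one_add_div_le_norm {z : ℂ} {a : ℝ} : 1 + z.re / a ≤ ‖1 + z / (a : ℂ)‖ := by
  refine le_trans (le_of_eq ?_) (Complex.re_le_norm _)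
  simp

lemma norm_one_add_div_le {z : ℂ} {a : ℝ} (ha : 1 ≤ a) : ‖1 + z / (a : ℂ)‖ ≤ 1 + ‖z‖ := by
  refine (norm_add_le _ _).trans ?_
  rw [norm_one, norm_div, Complex.norm_real, Real.norm_of_nonneg (by linarith)]
  gcongr
  exact div_le_self (norm_nonneg _) ha

lemma one_add_div_mem_slitPlane {z : ℂ} (hz : 0 ≤ z.re) {a : ℝ} (ha : 0 < a) :
    1 + z / (a : ℂ) ∈ Complex.slitPlane := by
  refine Or.inl ?_
  have : 0 ≤ z.re / a := by positivity
  simp only [Complex.add_re, Complex.one_re, Complex.div_ofReal_re]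
  linarith

lemma differentiableAt_outerLog (m : ℕ → ℕ) (b : ℝ) (N : ℕ) {z : ℂ} (hz : 0 ≤ z.re) :
    DifferentiableAt ℂ (outerLog m b N) z := by
  have h1 : ∀ a : ℝ, 0 < a → DifferentiableAt ℂ (fun z : ℂ => Complex.log (1 + z / (a : ℂ))) z :=
    fun a ha => DifferentiableAt.clog (by fun_prop) (one_add_div_mem_slitPlane hz ha)
  have h2 : DifferentiableAt ℂ (fun z : ℂ => Complex.log (1 + z)) z := by
    simpa using h1 1 one_pos
  unfold outerLog
  refine DifferentiableAt.sub ?_ h2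
  refine DifferentiableAt.fun_sum fun k _ => DifferentiableAt.fun_sum fun j _ => ?_
  exact (h1 _ (by positivity)).const_mul _

/-- Only finitely many factors occur, so the multiplier grows polynomially. This suffices for
Phragmén–Lindelöf; `W` may depend on `N`. -/
lemma exists_re_outerLog_le (m : ℕ → ℕ) {b : ℝ} (hb : 0 ≤ b) (N : ℕ) :
    ∃ W : ℝ, 0 ≤ W ∧ ∀ z : ℂ, 0 ≤ z.re →
      (outerLog m b N z).re ≤ W * Real.log (1 + ‖z‖) := by
  refine ⟨∑ k ∈ Finset.range N, ∑ j ∈ Finset.range (m k), b / (4 * m k) * 2 ^ j,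
    Finset.sum_nonneg fun k _ => Finset.sum_nonneg fun j _ => by positivity, fun z hz => ?_⟩
  rw [re_outerLog, Finset.sum_mul]
  have h1 : 0 ≤ Real.log ‖1 + z‖ := by
    have := one_add_div_le_norm (z := z) (a := 1)
    simp only [div_one, Complex.ofReal_one] at this
    exact Real.log_nonneg (by linarith)
  refine (sub_le_self _ h1).trans (Finset.sum_le_sum fun k _ => ?_)
  rw [Finset.sum_mul]
  refine Finset.sum_le_sum fun j _ => ?_
  have h2 : (1 : ℝ) ≤ 2 ^ j := one_le_pow₀ (by norm_num)
  have h3 : 0 < ‖1 + z / ((2 ^ j : ℝ) : ℂ)‖ :=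
    norm_pos_iff.2 (Complex.slitPlane_ne_zero (one_add_div_mem_slitPlane hz (by positivity)))
  gcongr
  exact norm_one_add_div_le h2

lemma norm_one_add_ofReal_mul_I (u : ℝ) : ‖1 + (u : ℂ) * Complex.I‖ = Real.sqrt (1 + u ^ 2) := by
  have := Complex.norm_add_mul_I 1 u
  simpa using this

/-- On the imaginary axis each inner sum is the one bounded in `sum_log_le_logBlock`. The term `-log
(1 + z)` gives the last summand, which later cancels the factor `1 + |x|`. -/
lemma re_outerLog_ofReal_mul_I_le {m : ℕ → ℕ} (hm : ∀ k, 2 ^ k ≤ m k) {b : ℝ} (hb : 0 ≤ b)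
    (N : ℕ) (x : ℝ) :
    (outerLog m b N (x * Complex.I)).re ≤
      b * logWeight m |x| - 1 / 2 * Real.log (1 + x ^ 2) := by
  have hlog : ∀ u : ℝ, Real.log ‖1 + (u : ℂ) * Complex.I‖ = 1 / 2 * Real.log (1 + u ^ 2) := by
    intro u
    rw [norm_one_add_ofReal_mul_I, Real.log_sqrt (by positivity)]
    ring
  rw [re_outerLog, hlog]
  refine sub_le_sub_right ?_ _
  have hk : ∀ k, ∑ j ∈ Finset.range (m k), b / (4 * m k) * 2 ^ j *
      Real.log ‖1 + (x : ℂ) * Complex.I / ((2 ^ j : ℝ) : ℂ)‖ ≤ b * logBlock (m k) |x| := by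
    intro k
    have hm1 := one_le_of_two_pow_le hm k
    have hm0 : (0 : ℝ) < m k := by exact_mod_cast hm1
    calc _ = b / (4 * m k) * ∑ j ∈ Finset.range (m k),
          (2 : ℝ) ^ j * (1 / 2 * Real.log (1 + (|x| / 2 ^ j) ^ 2)) := by
          rw [Finset.mul_sum]
          refine Finset.sum_congr rfl fun j _ => ?_
          rw [show (x : ℂ) * Complex.I / ((2 ^ j : ℝ) : ℂ) = ((x / 2 ^ j : ℝ) : ℂ) * Complex.I by
            push_cast; ring, hlog, div_pow, div_pow, sq_abs]
          ring
      _ ≤ b / (4 * m k) * (4 * m k * logBlock (m k) |x|) := by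
          gcongr
          exact sum_log_le_logBlock hm1 (abs_nonneg x)
      _ = b * logBlock (m k) |x| := by field_simp
  calc _ ≤ ∑ k ∈ Finset.range N, b * logBlock (m k) |x| := Finset.sum_le_sum fun k _ => hk k
    _ = b * ∑ k ∈ Finset.range N, logBlock (m k) |x| := by rw [Finset.mul_sum]
    _ ≤ b * logWeight m |x| := by
      gcongr
      exact sum_logBlock_le_logWeight hm (abs_nonneg x) N

/-- Each block has `m k` terms of weight `b / (4 * m k)`, and `2 ^ j * log (1 + x / 2 ^ j) ≥ x / (1
+ x)`. The contribution of a block is thus bounded below independently of `k`: this is the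
divergence of the logarithmic integral. -/
lemma le_re_outerLog {m : ℕ → ℕ} (hm : ∀ k, 2 ^ k ≤ m k) {b : ℝ} (hb : 0 ≤ b) (N : ℕ) {z : ℂ}
    (hz : 0 ≤ z.re) :
    N * (b / 4 * (z.re / (1 + z.re))) - Real.log ‖1 + z‖ ≤ (outerLog m b N z).re := by
  rw [re_outerLog]
  refine sub_le_sub_right ?_ _
  have hk : ∀ k, b / 4 * (z.re / (1 + z.re)) ≤ ∑ j ∈ Finset.range (m k), b / (4 * m k) * 2 ^ j *
      Real.log ‖1 + z / ((2 ^ j : ℝ) : ℂ)‖ := by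
    intro k
    have hm0 : (0 : ℝ) < m k := by exact_mod_cast one_le_of_two_pow_le hm k
    have hj : ∀ j, b / (4 * m k) * (z.re / (1 + z.re)) ≤ b / (4 * m k) * 2 ^ j *
      Real.log ‖1 + z / ((2 ^ j : ℝ) : ℂ)‖ := by
      intro j
      rw [mul_assoc]
      have h2 : (1 : ℝ) ≤ 2 ^ j := one_le_pow₀ (by norm_num)
      have h3 : 0 ≤ z.re / 2 ^ j := by positivity
      have h4 := Real.one_sub_inv_le_log_of_pos (show 0 < 1 + z.re / 2 ^ j by linarith)
      have h5 : Real.log (1 + z.re / 2 ^ j) ≤ Real.log ‖1 + z / ((2 ^ j : ℝ) : ℂ)‖ :=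
        Real.log_le_log (by linarith) one_add_div_le_norm
      gcongr
      calc z.re / (1 + z.re) ≤ z.re / (1 + z.re / 2 ^ j) := by
            gcongr
            exact div_le_self hz h2
        _ = 2 ^ j * (1 - (1 + z.re / 2 ^ j)⁻¹) := by field_simp; ring
        _ ≤ 2 ^ j * Real.log ‖1 + z / ((2 ^ j : ℝ) : ℂ)‖ := by gcongr; exact h4.trans h5
    calc b / 4 * (z.re / (1 + z.re))
        = ∑ j ∈ Finset.range (m k), b / (4 * m k) * (z.re / (1 + z.re)) := by
          rw [Finset.sum_const, Finset.card_range, nsmul_eq_mul]; field_simp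
      _ ≤ _ := Finset.sum_le_sum fun j _ => hj j
  calc (N : ℝ) * (b / 4 * (z.re / (1 + z.re)))
      = ∑ k ∈ Finset.range N, b / 4 * (z.re / (1 + z.re)) := by
        rw [Finset.sum_const, Finset.card_range, nsmul_eq_mul]
    _ ≤ _ := Finset.sum_le_sum fun k _ => hk k

/-- A function that is bounded on the right half-plane and decays on the boundary like
`exp (-b * logWeight m)` vanishes. -/
theorem eq_zero_of_norm_le_exp_neg_logWeight {m : ℕ → ℕ} (hm : ∀ k, 2 ^ k ≤ m k) {b : ℝ}
    (hb : 0 < b) {F : ℂ → ℂ} (hF : Differentiable ℂ F) {A : ℝ}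
    (hre : ∀ z : ℂ, 0 ≤ z.re → ‖F z‖ ≤ A * Real.exp (-z.re))
    (him : ∀ x : ℝ, ‖F (x * Complex.I)‖ ≤ A * ((1 + |x|) * Real.exp (-(b * logWeight m |x|))))
    {z : ℂ} (hz : 0 < z.re) : F z = 0 := by
  have hA : 0 ≤ A := by simpa using (norm_nonneg _).trans (hre 0 le_rfl)
  -- The bound does not depend on `N`, since the boundary estimate involves only the full `logWeight
  -- m`.
  have key : ∀ N : ℕ, ‖F z * Complex.exp (outerLog m b N z)‖ ≤ A * 2 := by
    intro N
    obtain ⟨W, hW0, hW⟩ := exists_re_outerLog_le m hb.le N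
    have hbound : ∀ z : ℂ, 0 ≤ z.re → ‖F z * Complex.exp (outerLog m b N z)‖ ≤
        A * Real.exp (-z.re) * Real.exp (W * Real.log (1 + ‖z‖)) := by
      intro z hz
      rw [norm_mul, Complex.norm_exp]
      gcongr
      · exact hre z hz
      · exact hW z hz
    refine PhragmenLindelof.right_half_plane_of_bounded_on_real
      (f := fun z => F z * Complex.exp (outerLog m b N z)) ?_ ⟨1, by norm_num, W, ?_⟩ ?_ ?_ hz.le
    · refine DifferentiableOn.diffContOnCl fun w hw => ?_
      have hw' : 0 ≤ w.re := by rwa [Complex.closure_setOfPred_lt_re] at hw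
      exact ((hF w).mul (differentiableAt_outerLog m b N hw').cexp).differentiableWithinAt
    · refine IsBigO.of_bound A ?_
      filter_upwards [mem_inf_of_right (mem_principal_self _)] with w hw
      have hw' : 0 ≤ w.re := le_of_lt hw
      refine (hbound w hw').trans ?_
      rw [Real.norm_of_nonneg (Real.exp_pos _).le, Real.rpow_one]
      have h1 : Real.exp (-w.re) ≤ 1 := Real.exp_le_one_iff.2 (by linarith)
      have h2 : Real.log (1 + ‖w‖) ≤ ‖w‖ := by
        have := Real.log_le_sub_one_of_pos (show 0 < 1 + ‖w‖ by positivity)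
        linarith
      calc A * Real.exp (-w.re) * Real.exp (W * Real.log (1 + ‖w‖))
          ≤ A * 1 * Real.exp (W * ‖w‖) := by gcongr
        _ = A * Real.exp (W * ‖w‖) := by ring
    · refine ⟨A, ?_⟩
      rw [eventually_map]
      have h1 := (isLittleO_log_one_add_div one_pos).const_mul W
      rw [mul_zero] at h1
      filter_upwards [h1.eventually (gt_mem_nhds one_pos), eventually_gt_atTop 0] with x hx hx0
      refine (hbound (x : ℂ) (by simpa using hx0.le)).trans ?_
      rw [mul_assoc, ← Real.exp_add]
      refine mul_le_of_le_one_right hA (Real.exp_le_one_iff.2 ?_)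
      rw [Complex.norm_real, Real.norm_of_nonneg hx0.le, Complex.ofReal_re]
      rw [div_one, ← mul_div_assoc, div_lt_one hx0] at hx
      linarith
    · intro x
      rw [norm_mul, Complex.norm_exp]
      have h1 := re_outerLog_ofReal_mul_I_le hm hb.le N x
      have h2 : (1 + |x|) * Real.exp (-(1 / 2 * Real.log (1 + x ^ 2))) ≤ 2 := by
        rw [Real.exp_neg, ← div_eq_mul_inv, div_le_iff₀ (Real.exp_pos _)]
        have h3 : Real.exp (1 / 2 * Real.log (1 + x ^ 2)) = Real.sqrt (1 + x ^ 2) := by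
          rw [show 1 / 2 * Real.log (1 + x ^ 2) = Real.log (1 + x ^ 2) / 2 by ring,
            ← Real.log_sqrt (by positivity), Real.exp_log (Real.sqrt_pos.2 (by positivity))]
        rw [h3]
        refine le_of_sq_le_sq ?_ (by positivity)
        rw [mul_pow, Real.sq_sqrt (by positivity)]
        nlinarith [sq_abs x, sq_nonneg (|x| - 1)]
      calc ‖F (x * Complex.I)‖ * Real.exp (outerLog m b N (x * Complex.I)).re
          ≤ A * ((1 + |x|) * Real.exp (-(b * logWeight m |x|))) *
            Real.exp (b * logWeight m |x| - 1 / 2 * Real.log (1 + x ^ 2)) := by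
            gcongr
            exact him x
        _ = A * ((1 + |x|) * Real.exp (-(1 / 2 * Real.log (1 + x ^ 2)))) := by
            rw [mul_assoc, mul_assoc, ← Real.exp_add]
            congr 4
            ring
        _ ≤ A * 2 := by gcongr
  -- Dividing by the multiplier leaves a bound proportional to `exp (-N * q)`, for every `N`.
  set q := b / 4 * (z.re / (1 + z.re)) with hq
  have hq0 : 0 < q := by positivity
  have hlim : Tendsto (fun N : ℕ => A * 2 * Real.exp (Real.log ‖1 + z‖) * Real.exp (-(N * q)))
      atTop (𝓝 (A * 2 * Real.exp (Real.log ‖1 + z‖) * 0)) := by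
    refine Tendsto.const_mul _ (Real.tendsto_exp_neg_atTop_nhds_zero.comp ?_)
    exact tendsto_natCast_atTop_atTop.atTop_mul_const hq0
  rw [mul_zero] at hlim
  refine norm_le_zero_iff.1 (ge_of_tendsto' hlim fun N => ?_)
  have h1 := key N
  rw [norm_mul, Complex.norm_exp] at h1
  have h2 := le_re_outerLog hm hb.le N hz.le
  rw [← hq] at h2
  calc ‖F z‖ = ‖F z‖ * Real.exp (outerLog m b N z).re * Real.exp (-(outerLog m b N z).re) := by
        rw [mul_assoc, ← Real.exp_add]; simp
    _ ≤ A * 2 * Real.exp (Real.log ‖1 + z‖ - N * q) := by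
        gcongr
        linarith
    _ = _ := by rw [sub_eq_add_neg, Real.exp_add, mul_assoc (A * 2)]

end HalfPlane

/-! ### Quasianalyticity on the line -/

section OneVariable

open FourierTransform

/-- Quasianalyticity in one variable. -/
theorem eq_zero_of_hasCompactSupport_of_iteratedDeriv_le {m : ℕ → ℕ} (hm : ∀ k, 2 ^ k ≤ m k)
    {g : ℝ → ℂ} (hg : ContDiff ℝ ((⊤ : ℕ∞) : WithTop ℕ∞) g) (hc : HasCompactSupport g) {C h : ℝ}
    (hC : 0 < C) (hh : 0 < h)
    (hB : ∀ (j : ℕ) (x : ℝ),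
      ‖iteratedDeriv j g x‖ ≤ C * Real.exp (1 / h * conjugate (truncWeight m) (h * j))) :
    g = 0 := by
  have hω := (truncWeight_isSemiregularFunction hm).toIsWeightFunction
  obtain ⟨A, hA, hdecay⟩ := norm_fourier_le_exp_neg_weight hω hg hc hC hh hB
  obtain ⟨a, A', hA', hgrowth⟩ := exists_norm_laplace_le hg.continuous hc
  set L : ℂ → ℂ := fun z => ∫ t : ℝ, g t * Complex.exp (-(z * t)) with hL
  have hLd : Differentiable ℂ L := differentiable_laplace hg.continuous hc
  have hfourier : ∀ w : ℝ, 𝓕 g w = L ((2 * Real.pi * w : ℝ) * Complex.I) := by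
    intro w
    rw [Real.fourier_real_eq_integral_exp_smul, hL]
    refine integral_congr_ae (Eventually.of_forall fun t => ?_)
    simp only [smul_eq_mul]
    rw [mul_comm]
    congr 2
    push_cast
    ring
  have hLim : ∀ x : ℝ, ‖L (x * Complex.I)‖ ≤
      A * Real.exp (logWeight m 1 / h) * ((1 + |x|) * Real.exp (-(1 / h * logWeight m |x|))) := by
    intro x
    have h1 := hdecay (x / (2 * Real.pi))
    rw [hfourier, mul_div_cancel₀ _ (by positivity)] at h1
    refine h1.trans ?_
    have h2 : Real.exp (-(truncWeight m |x| / h)) ≤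
        Real.exp (logWeight m 1 / h) * Real.exp (-(1 / h * logWeight m |x|)) := by
      rw [← Real.exp_add, Real.exp_le_exp]
      have := div_le_div_of_nonneg_right (logWeight_le_truncWeight_add m |x|) hh.le
      rw [add_div] at this
      rw [one_div_mul_eq_div]
      linarith
    calc _ ≤ A * ((1 + |x|) *
          (Real.exp (logWeight m 1 / h) * Real.exp (-(1 / h * logWeight m |x|)))) := by gcongr
      _ = _ := by ring
  set A₁ := max A' (A * Real.exp (logWeight m 1 / h))
  have hzero : ∀ z : ℂ, 0 < z.re → L z = 0 := by
    intro z hz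
    -- The factor `exp (-(a + 1) z)` cancels the growth `exp (a * z.re)`, leaves `exp (-z.re)`, and
    -- has modulus one on the imaginary axis.
    have := eq_zero_of_norm_le_exp_neg_logWeight hm (b := 1 / h) (by positivity)
      (F := fun z => L z * Complex.exp (-((a + 1 : ℝ) * z))) (A := A₁)
      (hLd.mul (by fun_prop)) ?_ ?_ hz
    · exact (mul_eq_zero.1 this).resolve_right (Complex.exp_ne_zero _)
    · intro w hw
      rw [norm_mul, Complex.norm_exp]
      calc _ ≤ A' * Real.exp (a * w.re) * Real.exp (-((a + 1) * w.re)) := by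
            gcongr
            · exact hgrowth w hw
            · simp
        _ = A' * Real.exp (-w.re) := by
            rw [mul_assoc, ← Real.exp_add]; congr 2; ring
        _ ≤ _ := by gcongr; exact le_max_left _ _
    · intro x
      rw [norm_mul, Complex.norm_exp]
      have : (-(((a + 1 : ℝ) : ℂ) * (x * Complex.I))).re = 0 := by simp
      rw [this, Real.exp_zero, mul_one]
      refine (hLim x).trans ?_
      gcongr
      exact le_max_right _ _
  have hfz : 𝓕 g = 0 := by
    funext w
    rw [hfourier]
    -- The zero set reaches the boundary by continuity, and there `L` is the Fourier transform.
    set z₀ : ℂ := (2 * Real.pi * w : ℝ) * Complex.I with hz₀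
    have h1 : Tendsto (fun ε : ℝ => L (z₀ + ε)) (𝓝[>] 0) (𝓝 (L z₀)) := by
      have : Continuous fun ε : ℝ => L (z₀ + ε) := hLd.continuous.comp (by fun_prop)
      simpa using (this.tendsto 0).mono_left nhdsWithin_le_nhds
    refine tendsto_nhds_unique (h1.congr' ?_) tendsto_const_nhds
    filter_upwards [self_mem_nhdsWithin] with ε hε
    refine hzero _ ?_
    have : z₀.re = 0 := by simp [hz₀]
    simpa [this] using hε
  have hinv := hg.continuous.fourierInv_fourier_eq
    (hg.continuous.integrable_of_hasCompactSupport hc) (by rw [hfz]; exact integrable_zero _ _ _)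
  rw [← hinv, hfz]
  funext w
  simp [Real.fourierInv_eq']

end OneVariable

/-! ### Reduction from several variables to one -/

section MixedPartial

variable {n : ℕ}

lemma iteratedFDeriv_apply_const_congr {E F : Type*} [NormedAddCommGroup E] [NormedSpace ℝ E]
    [NormedAddCommGroup F] [NormedSpace ℝ F] {a b : ℕ} (hab : a = b) (f : E → F) (x v : E) :
    iteratedFDeriv ℝ a f x (fun _ => v) = iteratedFDeriv ℝ b f x (fun _ => v) := by
  subst hab
  rfl

lemma mixedPartial_single (i : Fin n) (j : ℕ) (f : EuclideanSpace ℝ (Fin n) → ℂ)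
    (x : EuclideanSpace ℝ (Fin n)) :
    mixedPartial (Pi.single i j) f x =
      iteratedFDeriv ℝ j f x (fun _ => EuclideanSpace.single i (1 : ℝ)) := by
  have hsum : ∑ l, (Pi.single i j : Fin n → ℕ) l = j := by simp
  rw [← iteratedFDeriv_apply_const_congr hsum, mixedPartial]
  congr 1
  funext l
  -- Fibres over the other indices are empty, so every slot carries the index `i`.
  have hl : (finSigmaFinEquiv.symm l).1 = i := by
    by_contra hne
    have h := Nat.zero_lt_of_lt (finSigmaFinEquiv.symm l).2.isLt
    rw [Pi.single_eq_of_ne hne] at h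
    exact lt_irrefl 0 h
  rw [hl]

lemma mixedPartial_congr {f g : EuclideanSpace ℝ (Fin n) → ℂ} {x : EuclideanSpace ℝ (Fin n)}
    (h : f =ᶠ[𝓝 x] g) (α : Fin n → ℕ) : mixedPartial α f x = mixedPartial α g x := by
  rw [mixedPartial, mixedPartial, (Filter.EventuallyEq.iteratedFDeriv ℝ h _).eq_of_nhds]

lemma mixedPartial_zero_fun (α : Fin n → ℕ) (x : EuclideanSpace ℝ (Fin n)) :
    mixedPartial α (fun _ => 0) x = 0 := by
  have : iteratedFDeriv ℝ (∑ i, α i) (fun _ : EuclideanSpace ℝ (Fin n) => (0 : ℂ)) = 0 :=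
    iteratedFDeriv_fun_zero
  rw [mixedPartial, this]
  rfl

lemma iteratedDeriv_comp_line {f : EuclideanSpace ℝ (Fin n) → ℂ}
    (hf : ContDiff ℝ ((⊤ : ℕ∞) : WithTop ℕ∞) f) (x : EuclideanSpace ℝ (Fin n)) (i : Fin n)
    (j : ℕ) (t : ℝ) :
    iteratedDeriv j (fun t : ℝ => f (x + t • EuclideanSpace.single i (1 : ℝ))) t =
      mixedPartial (Pi.single i j) f (x + t • EuclideanSpace.single i (1 : ℝ)) := by
  have h := (ContinuousLinearMap.toSpanSingleton ℝ
    (EuclideanSpace.single i (1 : ℝ))).iteratedFDeriv_comp_right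
    (f := fun y => f (x + y)) (n := ((⊤ : ℕ∞) : WithTop ℕ∞)) (hf.comp (by fun_prop)) t (i := j)
    (by exact_mod_cast le_top)
  rw [iteratedDeriv_eq_iteratedFDeriv, mixedPartial_single]
  have h2 := congrArg (fun A => A (fun _ => (1 : ℝ))) h
  simpa [iteratedFDeriv_comp_add_left, Function.comp_def] using h2

/-- Extend `f` by zero and restrict to the line through `x` parallel to the first axis. Pure partial
derivatives inherit the class bounds, and the restriction has compact support. -/
theorem isQuasianalyticOn_truncWeight {m : ℕ → ℕ} (hm : ∀ k, 2 ^ k ≤ m k) (hn : 1 ≤ n)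
    {Ω : Set (EuclideanSpace ℝ (Fin n))} (hΩ : IsOpen Ω) :
    IsQuasianalyticOn (roumieuFunction (truncWeight m) Ω) Ω := by
  rintro f ⟨hf, hfK⟩ K hK hKΩ hzero x hx
  obtain ⟨C, h, hC, hh, hB⟩ := hfK K hK hKΩ
  set F := Ω.indicator f with hFdef
  have hFΩ : ∀ y ∈ Ω, F =ᶠ[𝓝 y] f := fun y hy => by
    filter_upwards [hΩ.mem_nhds hy] with z hz
    exact Set.indicator_of_mem hz f
  have hFK : ∀ y ∉ K, F =ᶠ[𝓝 y] fun _ => 0 := fun y hy => by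
    filter_upwards [hK.isClosed.isOpen_compl.mem_nhds hy] with z hz
    by_cases hzΩ : z ∈ Ω
    · rw [hFdef, Set.indicator_of_mem hzΩ, hzero z ⟨hzΩ, hz⟩]
    · exact Set.indicator_of_notMem hzΩ f
  have hF : ContDiff ℝ ((⊤ : ℕ∞) : WithTop ℕ∞) F := by
    refine contDiff_iff_contDiffAt.2 fun y => ?_
    by_cases hy : y ∈ K
    · exact (hf.contDiffAt (hΩ.mem_nhds (hKΩ hy))).congr_of_eventuallyEq (hFΩ y (hKΩ hy))
    · exact contDiffAt_const.congr_of_eventuallyEq (hFK y hy)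
  set i : Fin n := ⟨0, hn⟩
  have hbound : ∀ (j : ℕ) (y : EuclideanSpace ℝ (Fin n)),
      ‖mixedPartial (Pi.single i j) F y‖ ≤
        C * Real.exp (1 / h * conjugate (truncWeight m) (h * j)) := by
    intro j y
    by_cases hy : y ∈ K
    · rw [mixedPartial_congr (hFΩ y (hKΩ hy))]
      simpa using hB (Pi.single i j) y hy
    · rw [mixedPartial_congr (hFK y hy), mixedPartial_zero_fun, norm_zero]
      positivity
  have hline : ContDiff ℝ ((⊤ : ℕ∞) : WithTop ℕ∞)
      (fun t : ℝ => F (x + t • EuclideanSpace.single i (1 : ℝ))) := hF.comp (by fun_prop)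
  have hsupp : HasCompactSupport (fun t : ℝ => F (x + t • EuclideanSpace.single i (1 : ℝ))) := by
    obtain ⟨R, hR⟩ := hK.isBounded.exists_norm_le
    refine HasCompactSupport.intro (isCompact_closedBall (0 : ℝ) (R + ‖x‖)) fun t ht => ?_
    refine (hFK _ fun hmem => ht ?_).self_of_nhds
    have h1 := norm_sub_le (x + t • EuclideanSpace.single i (1 : ℝ)) x
    rw [add_sub_cancel_left, norm_smul, PiLp.norm_single, norm_one, mul_one] at h1
    rw [mem_closedBall_zero_iff]
    linarith [hR _ hmem]
  have h0 := congrFun (eq_zero_of_hasCompactSupport_of_iteratedDeriv_le hm hline hsupp hC hh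
    (fun j t => by rw [iteratedDeriv_comp_line hF]; exact hbound j _)) 0
  simpa [hFdef, hx] using h0

end MixedPartial

/-! ### Exponential series with large derivatives -/

/-- The point is that the supremum is finite, as `log t = o(ω t)`; for an unbounded set `sSup` would
be the default value `0`. -/
lemma IsWeightFunction.le_conjugate {ω : ℝ → ℝ} (hω : IsWeightFunction ω) (y : ℝ) {s : ℝ}
    (hs : 0 ≤ s) : s * y - ω (Real.exp s) ≤ conjugate ω y := by
  refine le_csSup ?_ ⟨s, hs, rfl⟩
  obtain ⟨N, hN⟩ := exists_nat_ge y
  obtain ⟨s₀, hs₀⟩ := eventually_atTop.1 (Real.tendsto_exp_atTop.eventually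
    (Asymptotics.isLittleO_iff_nat_mul_le.1 hω.log_isLittleO N))
  refine ⟨N * max s₀ 0, ?_⟩
  rintro _ ⟨u, hu, rfl⟩
  have hu : (0 : ℝ) ≤ u := hu
  have h1 : u * y ≤ N * u := by rw [mul_comm]; gcongr
  have hpos := hω.nonneg _ (Real.exp_pos u).le
  simp only
  rcases le_total s₀ u with h | h
  · have := hs₀ u h
    rw [Real.log_exp, Real.norm_of_nonneg hu, Real.norm_of_nonneg hpos] at this
    have : 0 ≤ (N : ℝ) * max s₀ 0 := by positivity
    linarith
  · have : (N : ℝ) * u ≤ N * max s₀ 0 := by gcongr; exact h.trans (le_max_left _ _)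
    linarith

lemma IsWeightFunction.exp_neg_mul_pow_le {ω : ℝ → ℝ} (hω : IsWeightFunction ω) {t : ℝ}
    (ht : 1 ≤ t) (j : ℕ) : Real.exp (-ω t) * t ^ j ≤ Real.exp (conjugate ω j) := by
  have htp : 0 < t := by linarith
  have h := hω.le_conjugate j (Real.log_nonneg ht)
  rw [Real.exp_log htp] at h
  have e1 : t ^ j = Real.exp (j * Real.log t) := by
    rw [← Real.log_pow, Real.exp_log (by positivity)]
  rw [e1, ← Real.exp_add, Real.exp_le_exp]
  linarith

section ExponentialSeries

lemma iteratedDeriv_mul_cexp (a c : ℂ) (j : ℕ) :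
    iteratedDeriv j (fun y : ℝ => a * Complex.exp (c * y)) =
      fun y : ℝ => c ^ j * (a * Complex.exp (c * y)) := by
  induction j with
  | zero => simp
  | succ j ih =>
    rw [iteratedDeriv_succ, ih]
    funext y
    have h1 : HasDerivAt (fun y : ℝ => c * (y : ℂ)) c y := by
      simpa using (Complex.ofRealCLM.hasDerivAt (x := y)).const_mul c
    rw [((h1.cexp.const_mul a).const_mul (c ^ j)).deriv]
    ring

variable {a T : ℕ → ℝ}

/-- The exponential series `∑ a_k exp (i T_k y)`. -/
noncomputable def expSeries (a T : ℕ → ℝ) (y : ℝ) : ℂ :=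
  ∑' k, (a k : ℂ) * Complex.exp ((T k * Complex.I : ℂ) * y)

lemma norm_iteratedFDeriv_expSeries_term (ha : ∀ k, 0 ≤ a k) (hT : ∀ k, 0 ≤ T k) (j k : ℕ)
    (y : ℝ) :
    ‖iteratedFDeriv ℝ j (fun y : ℝ => (a k : ℂ) * Complex.exp ((T k * Complex.I : ℂ) * y)) y‖ =
      a k * T k ^ j := by
  rw [norm_iteratedFDeriv_eq_norm_iteratedDeriv, iteratedDeriv_mul_cexp]
  simp [Complex.norm_exp, abs_of_nonneg (ha k), abs_of_nonneg (hT k), mul_comm]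

lemma contDiff_expSeries_term (k : ℕ) : ContDiff ℝ ((⊤ : ℕ∞) : WithTop ℕ∞)
    (fun y : ℝ => (a k : ℂ) * Complex.exp ((T k * Complex.I : ℂ) * y)) := by
  have : ContDiff ℝ ((⊤ : ℕ∞) : WithTop ℕ∞) (fun y : ℝ => (y : ℂ)) := Complex.ofRealCLM.contDiff
  fun_prop

lemma contDiff_expSeries (ha : ∀ k, 0 ≤ a k) (hT : ∀ k, 0 ≤ T k)
    (hs : ∀ j, Summable fun k => a k * T k ^ j) :
    ContDiff ℝ ((⊤ : ℕ∞) : WithTop ℕ∞) (expSeries a T) :=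
  contDiff_tsum (𝕜 := ℝ) (N := ⊤) (fun k => contDiff_expSeries_term k) (fun j _ => hs j)
    (fun j k y _ => (norm_iteratedFDeriv_expSeries_term ha hT j k y).le)

lemma iteratedFDeriv_expSeries (ha : ∀ k, 0 ≤ a k) (hT : ∀ k, 0 ≤ T k)
    (hs : ∀ j, Summable fun k => a k * T k ^ j) (j : ℕ) (y : ℝ) :
    iteratedFDeriv ℝ j (expSeries a T) y = ∑' k, iteratedFDeriv ℝ j
      (fun y : ℝ => (a k : ℂ) * Complex.exp ((T k * Complex.I : ℂ) * y)) y :=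
  iteratedFDeriv_tsum_apply (𝕜 := ℝ) (N := ⊤) (fun k => contDiff_expSeries_term k) (fun j _ => hs j)
    (fun j k y _ => (norm_iteratedFDeriv_expSeries_term ha hT j k y).le) le_top y

lemma norm_iteratedFDeriv_expSeries_le (ha : ∀ k, 0 ≤ a k) (hT : ∀ k, 0 ≤ T k)
    (hs : ∀ j, Summable fun k => a k * T k ^ j) (j : ℕ) (y : ℝ) :
    ‖iteratedFDeriv ℝ j (expSeries a T) y‖ ≤ ∑' k, a k * T k ^ j := by
  rw [iteratedFDeriv_expSeries ha hT hs]
  exact tsum_of_norm_bounded (hs j).hasSum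
    (fun k => (norm_iteratedFDeriv_expSeries_term ha hT j k y).le)

/-- At the origin all terms have the same phase `I ^ j`, so nothing cancels and each term bounds the
sum from below. -/
lemma le_norm_iteratedDeriv_expSeries (ha : ∀ k, 0 ≤ a k) (hT : ∀ k, 0 ≤ T k)
    (hs : ∀ j, Summable fun k => a k * T k ^ j) (j k : ℕ) :
    a k * T k ^ j ≤ ‖iteratedDeriv j (expSeries a T) 0‖ := by
  have hsum : Summable fun k => iteratedFDeriv ℝ j
      (fun y : ℝ => (a k : ℂ) * Complex.exp ((T k * Complex.I : ℂ) * y)) 0 :=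
    Summable.of_norm_bounded (hs j)
      (fun k => (norm_iteratedFDeriv_expSeries_term ha hT j k 0).le)
  have h1 : iteratedDeriv j (expSeries a T) 0 = Complex.I ^ j * ((∑' k, a k * T k ^ j : ℝ) : ℂ) := by
    rw [iteratedDeriv_eq_iteratedFDeriv, iteratedFDeriv_expSeries ha hT hs,
      ContinuousMultilinearMap.tsum_eval hsum, Complex.ofReal_tsum, ← tsum_mul_left]
    refine tsum_congr fun k => ?_
    rw [← iteratedDeriv_eq_iteratedFDeriv, iteratedDeriv_mul_cexp]
    simp
    ring
  have hnn : ∀ k, 0 ≤ a k * T k ^ j := fun k => mul_nonneg (ha k) (pow_nonneg (hT k) j)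
  rw [h1, norm_mul, norm_pow, Complex.norm_I, one_pow, one_mul, Complex.norm_real,
    Real.norm_of_nonneg (tsum_nonneg hnn)]
  exact (hs j).le_tsum k fun l _ => hnn l

end ExponentialSeries

/-- Every weight class contains functions whose derivatives at a given point are large. -/
theorem exists_mem_roumieuFunction {ω : ℝ → ℝ} (hω : IsWeightFunction ω) {n : ℕ} (i : Fin n)
    (Ω : Set (EuclideanSpace ℝ (Fin n))) (p : EuclideanSpace ℝ (Fin n)) {T : ℕ → ℝ}
    (hT : ∀ k, 1 ≤ T k) :
    ∃ f ∈ roumieuFunction ω Ω, ∀ j k : ℕ,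
      (1 / 2) ^ k * Real.exp (-ω (T k)) * T k ^ j ≤ ‖mixedPartial (Pi.single i j) f p‖ := by
  set a : ℕ → ℝ := fun k => (1 / 2) ^ k * Real.exp (-ω (T k)) with haDef
  have ha : ∀ k, 0 ≤ a k := fun k => by positivity
  have hT0 : ∀ k, 0 ≤ T k := fun k => zero_le_one.trans (hT k)
  have hle : ∀ j k : ℕ, a k * T k ^ j ≤ (1 / 2) ^ k * Real.exp (conjugate ω j) := fun j k => by
    rw [haDef, mul_assoc]
    gcongr
    exact hω.exp_neg_mul_pow_le (hT k) j
  have hgeom := fun j : ℕ => summable_geometric_two.mul_right (Real.exp (conjugate ω j))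
  have hs : ∀ j, Summable fun k => a k * T k ^ j := fun j =>
    Summable.of_nonneg_of_le (fun k => mul_nonneg (ha k) (pow_nonneg (hT0 k) j)) (hle j) (hgeom j)
  have hG := contDiff_expSeries ha hT0 hs
  -- The function depends on the `i`-th coordinate only, translated so that `p` corresponds to the
  -- origin.
  set H : ℝ → ℂ := fun y => expSeries a T (-(p i) + y) with hH
  have hHs : ContDiff ℝ ((⊤ : ℕ∞) : WithTop ℕ∞) H := hG.comp (by fun_prop)
  set π : EuclideanSpace ℝ (Fin n) →L[ℝ] ℝ := EuclideanSpace.proj i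
  have hder : ∀ (j : ℕ) (x : EuclideanSpace ℝ (Fin n)), iteratedFDeriv ℝ j (H ∘ π) x =
      (iteratedFDeriv ℝ j (expSeries a T) (-(p i) + x i)).compContinuousLinearMap fun _ => π := by
    intro j x
    rw [π.iteratedFDeriv_comp_right hHs x (by exact_mod_cast le_top), hH,
      iteratedFDeriv_comp_add_left]
    rfl
  refine ⟨H ∘ π, ⟨(hHs.comp π.contDiff).contDiffOn, fun K _ _ => ⟨2, 1, two_pos, one_pos,
    fun α x _ => ?_⟩⟩, fun j k => ?_⟩
  · rw [mixedPartial, hder, ContinuousMultilinearMap.compContinuousLinearMap_apply]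
    refine (ContinuousMultilinearMap.le_opNorm _ _).trans ?_
    have h1 : ∀ {N : ℕ} (v : Fin N → Fin n),
        ∏ l, ‖π (EuclideanSpace.single (v l) (1 : ℝ))‖ ≤ 1 := by
      exact fun v => Finset.prod_le_one (fun _ _ => norm_nonneg _) fun l _ =>
        (PiLp.norm_apply_le (EuclideanSpace.single (v l) (1 : ℝ)) i).trans (by simp)
    refine (mul_le_of_le_one_right (norm_nonneg _) (h1 _)).trans ?_
    refine (norm_iteratedFDeriv_expSeries_le ha hT0 hs _ _).trans ?_
    refine ((hs _).tsum_le_tsum (hle _) (hgeom _)).trans (le_of_eq ?_)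
    rw [tsum_mul_right, tsum_geometric_two]
    simp
  · refine (le_norm_iteratedDeriv_expSeries ha hT0 hs j k).trans (le_of_eq ?_)
    rw [mixedPartial_single, hder, ContinuousMultilinearMap.compContinuousLinearMap_apply,
      iteratedDeriv_eq_iteratedFDeriv]
    simp [π]

/-! ### Interlaced scales and non-inclusion -/

lemma exists_interlaced_sequences (Φ : ℕ → ℕ → ℝ) :
    ∃ m T : ℕ → ℕ, (∀ k, 2 ^ k ≤ m k) ∧ (∀ k, m k ≤ T k) ∧ (∀ k, Φ k (m k) ≤ T k) ∧
      ∀ k, m (k + 1) = 2 ^ (k + 1) * T k := by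
  set S : ℕ → ℕ → ℕ := fun k x => max x ⌈Φ k x⌉₊
  set m : ℕ → ℕ := fun k => Nat.rec 1 (fun k x => 2 ^ (k + 1) * S k x) k
  have hm : ∀ k, m (k + 1) = 2 ^ (k + 1) * S k (m k) := fun k => rfl
  have hmS : ∀ k, m k ≤ S k (m k) := fun k => le_max_left _ _
  refine ⟨m, fun k => S k (m k), fun k => ?_, hmS, fun k => ?_, hm⟩
  · induction k with
    | zero => exact le_rfl
    | succ k ih =>
      rw [hm]
      exact Nat.le_mul_of_pos_right _ ((Nat.two_pow_pos k).trans_le (ih.trans (hmS k)))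
  · exact (Nat.le_ceil _).trans (by exact_mod_cast le_max_right _ _)

/-- At `T k` the blocks up to `k` are estimated logarithmically. Later ones are estimated by `T k /
m`, and the choice of `m (k + 1)` makes these a geometric series of sum at most 2. -/
lemma logWeight_le_of_interlaced {m T : ℕ → ℕ} (hm : ∀ k, 2 ^ k ≤ m k) (hmT : ∀ k, m k ≤ T k)
    (hsucc : ∀ k, m (k + 1) = 2 ^ (k + 1) * T k) (k : ℕ) :
    logWeight m (T k) ≤ ((k + 1) * 2 ^ m k : ℕ) * Real.log (1 + T k) + 2 := by
  have hT1 : ∀ k, 1 ≤ T k := fun k => (one_le_of_two_pow_le hm k).trans (hmT k)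
  have hTm : ∀ k, T k ≤ m (k + 1) := fun k => by
    rw [hsucc]; exact Nat.le_mul_of_pos_left _ (Nat.two_pow_pos _)
  have hTmono : Monotone T := monotone_nat_of_le_succ fun k => (hTm k).trans (hmT _)
  have hmmono : Monotone m := monotone_nat_of_le_succ fun k => (hmT k).trans (hTm k)
  have hT0 : (0 : ℝ) ≤ T k := Nat.cast_nonneg _
  have hs := summable_logBlock hm hT0
  rw [logWeight, ← hs.sum_add_tsum_nat_add (k + 1)]
  have hlog : 0 ≤ Real.log (1 + T k) := Real.log_nonneg (by linarith)
  refine add_le_add ?_ ?_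
  · calc ∑ l ∈ Finset.range (k + 1), logBlock (m l) (T k)
        ≤ ∑ l ∈ Finset.range (k + 1), 2 ^ m k * Real.log (1 + T k) := by
          refine Finset.sum_le_sum fun l hl => (logBlock_le_log _ hT0).trans ?_
          have : m l ≤ m k := hmmono (Nat.lt_succ_iff.1 (Finset.mem_range.1 hl))
          gcongr
          norm_num
      _ = ((k + 1) * 2 ^ m k : ℕ) * Real.log (1 + T k) := by
          rw [Finset.sum_const, Finset.card_range, nsmul_eq_mul]
          push_cast
          ring
  · rw [← tsum_geometric_two]
    refine ((summable_nat_add_iff (k + 1)).2 hs).tsum_le_tsum (fun l => ?_) summable_geometric_two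
    refine (logBlock_le_div _ hT0).trans ?_
    have h1 : (2 : ℝ) ^ l * T k ≤ m (l + (k + 1)) := by
      have h2 : 2 ^ l * T k ≤ 2 ^ (l + k + 1) * T (l + k) :=
        Nat.mul_le_mul (Nat.pow_le_pow_right two_pos (by omega)) (hTmono (by omega))
      rw [← add_assoc, hsucc]
      exact_mod_cast h2
    have hTp : (0 : ℝ) < T k := by exact_mod_cast hT1 k
    calc (T k : ℝ) / m (l + (k + 1)) ≤ T k / (2 ^ l * T k) := by gcongr
      _ = (1 / 2) ^ l := by rw [one_div_pow]; field_simp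

theorem exists_quasianalytic_not_subset (M : ℕ → ℕ → ℝ) (hpos : ∀ l k, 0 < M l k)
    (hmono : ∀ l₁ l₂, l₁ ≤ l₂ → ∀ k, M l₁ k ≤ M l₂ k) :
    ∃ ω : ℝ → ℝ, IsSemiregularFunction ω ∧ IsAlmostSubadditive ω ∧
      (∀ (n : ℕ) (Ω : Set (EuclideanSpace ℝ (Fin n))), 1 ≤ n → IsOpen Ω →
        IsQuasianalyticOn (roumieuFunction ω Ω) Ω) ∧
      (∀ (n : ℕ) (Ω : Set (EuclideanSpace ℝ (Fin n))), 1 ≤ n → IsOpen Ω → Ω.Nonempty →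
        ¬ roumieuFunction ω Ω ⊆ roumieuMatrix (Set.range M) Ω) := by
  set B : ℕ → ℕ → ℕ := fun k x => (k + 1) * 2 ^ x with hBdef
  -- The demand on `T k` collects all later losses: `2 ^ k` from the series coefficient, `8 * 2 ^ B`
  -- from `exp (ω (T k))`, and `(k + 1) ^ (B + 2)` from `C * h ^ (B + 1)`.
  obtain ⟨m, T, hm, hmT, hΦ, hsucc⟩ := exists_interlaced_sequences fun k x =>
    2 ^ k * 8 * 2 ^ B k x * (k + 1) ^ (B k x + 2) * M k (B k x + 1)
  have hω := truncWeight_isSemiregularFunction hm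
  refine ⟨truncWeight m, hω, truncWeight_isAlmostSubadditive hm,
    fun n Ω hn hΩ => isQuasianalyticOn_truncWeight hm hn hΩ, ?_⟩
  rintro n Ω hn - ⟨p, hp⟩ hsub
  have hT1 : ∀ k, (1 : ℝ) ≤ T k := fun k => by
    exact_mod_cast (one_le_of_two_pow_le hm k).trans (hmT k)
  obtain ⟨f, hf, hlow⟩ := exists_mem_roumieuFunction hω.toIsWeightFunction ⟨0, hn⟩ Ω p hT1
  obtain ⟨-, hfK⟩ := hsub hf
  obtain ⟨_, ⟨l, rfl⟩, C, h, hC, hh, hup⟩ :=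
    hfK {p} isCompact_singleton (Set.singleton_subset_iff.2 hp)
  obtain ⟨k₁, hk₁⟩ := exists_nat_ge C
  obtain ⟨k₂, hk₂⟩ := exists_nat_ge h
  -- One index dominates the member of the family and both constants. The contradiction comes at
  -- order `b + 1`, one above the power of `t` in the bound for `exp (ω t)`.
  set k := max l (max k₁ k₂)
  have hlk : l ≤ k := le_max_left _ _
  have hCk : C ≤ k + 1 := by
    have : (k₁ : ℝ) ≤ k := by exact_mod_cast (le_max_left k₁ k₂).trans (le_max_right _ _)
    linarith
  have hhk : h ≤ k + 1 := by
    have : (k₂ : ℝ) ≤ k := by exact_mod_cast (le_max_right k₁ k₂).trans (le_max_right _ _)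
    linarith
  set b := B k (m k) with hb
  set t : ℝ := (T k : ℝ) with ht
  have ht1 : 1 ≤ t := hT1 k
  have hMpos := hpos k (b + 1)
  have hω_le : truncWeight m t ≤ b * Real.log (1 + t) + 2 :=
    (truncWeight_le m (by linarith)).trans (logWeight_le_of_interlaced hm hmT hsucc k)
  have hexp : Real.exp (truncWeight m t) < 8 * (2 ^ b * t ^ b) := by
    -- This strict inequality is what contradicts the non-strict `hΦ`.
    have h8 : Real.exp 2 < 8 := by
      have := Real.exp_one_lt_d9
      rw [show (2 : ℝ) = 1 + 1 by norm_num, Real.exp_add]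
      nlinarith [Real.exp_pos 1]
    calc Real.exp (truncWeight m t) ≤ Real.exp (b * Real.log (1 + t) + 2) :=
          Real.exp_le_exp.2 hω_le
      _ = Real.exp 2 * (1 + t) ^ b := by
          rw [Real.exp_add, ← Real.log_pow, Real.exp_log (by positivity), mul_comm]
      _ < 8 * (1 + t) ^ b := by gcongr
      _ ≤ 8 * (2 * t) ^ b := by gcongr; linarith
      _ = 8 * (2 ^ b * t ^ b) := by rw [mul_pow]
  have hup' : (1 / 2) ^ k * Real.exp (-truncWeight m t) * t ^ (b + 1) ≤
      (k + 1) ^ (b + 2) * M k (b + 1) := by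
    refine (hlow (b + 1) k).trans ((hup _ p rfl).trans ?_)
    rw [show ∑ i, (Pi.single (⟨0, hn⟩ : Fin n) (b + 1) : Fin n → ℕ) i = b + 1 by simp]
    calc C * h ^ (b + 1) * M l (b + 1) ≤ (k + 1) * (k + 1) ^ (b + 1) * M k (b + 1) := by
          have := (hpos l (b + 1)).le
          have := hmono l k hlk (b + 1)
          gcongr
      _ = (k + 1) ^ (b + 2) * M k (b + 1) := by ring
  have hlt : t * t ^ b < (2 ^ k * 8 * 2 ^ b * (k + 1) ^ (b + 2) * M k (b + 1)) * t ^ b := by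
    calc t * t ^ b = 2 ^ k * Real.exp (truncWeight m t) *
          ((1 / 2) ^ k * Real.exp (-truncWeight m t) * t ^ (b + 1)) := by
          rw [Real.exp_neg, one_div_pow, pow_succ]
          field_simp
      _ ≤ 2 ^ k * Real.exp (truncWeight m t) * ((k + 1) ^ (b + 2) * M k (b + 1)) := by gcongr
      _ < 2 ^ k * (8 * (2 ^ b * t ^ b)) * ((k + 1) ^ (b + 2) * M k (b + 1)) := by gcongr
      _ = _ := by ring
  exact absurd (hΦ k) (not_le.2 (lt_of_mul_lt_mul_right hlt (by positivity)))

/-! ### A countable family dominating all semiregular sequences -/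

/-- Iterating `M (k + 1) ≤ Q ^ (k + 1) * M k` gives `Q ^ (k * (k + 1) / 2)`; a base `l + 1` above
both `Q` and `1` allows the exponent `k ^ 2`. -/
lemma IsSemiregularSequence.exists_le_pow_sq {M : ℕ → ℝ} (hM : IsSemiregularSequence M) :
    ∃ l : ℕ, ∀ k, M k ≤ ((l : ℝ) + 1) ^ k ^ 2 := by
  obtain ⟨Q, hQ, hMQ⟩ := hM.deriv_closed
  obtain ⟨l, hl⟩ := exists_nat_ge Q
  refine ⟨l, fun k => ?_⟩
  induction k with
  | zero => simp [hM.zero]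
  | succ k ih =>
    have hl1 : (1 : ℝ) ≤ l + 1 := by linarith [(Nat.cast_nonneg l : (0 : ℝ) ≤ l)]
    calc M (k + 1) ≤ Q ^ (k + 1) * M k := hMQ k
      _ ≤ ((l : ℝ) + 1) ^ (k + 1) * ((l : ℝ) + 1) ^ k ^ 2 := by
        have := (hM.pos k).le
        gcongr
        linarith
      _ = ((l : ℝ) + 1) ^ (k + 1 + k ^ 2) := (pow_add _ _ _).symm
      _ ≤ ((l : ℝ) + 1) ^ (k + 1) ^ 2 := pow_le_pow_right₀ hl1 (by nlinarith)

lemma roumieuSequence_subset_roumieuMatrix {n : ℕ} {M N : ℕ → ℝ} {𝔐 : Set (ℕ → ℝ)} (hN : N ∈ 𝔐)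
    (hMN : ∀ k, M k ≤ N k) (Ω : Set (EuclideanSpace ℝ (Fin n))) :
    roumieuSequence M Ω ⊆ roumieuMatrix 𝔐 Ω := by
  rintro f ⟨hf, hfK⟩
  refine ⟨hf, fun K hK hKΩ => ?_⟩
  obtain ⟨C, h, hC, hh, hB⟩ := hfK K hK hKΩ
  refine ⟨N, hN, C, h, hC, hh, fun α x hx => (hB α x hx).trans ?_⟩
  gcongr
  exact hMN _

end Ultradiff

theorem theoremB1 :
    (∀ M : ℕ → ℕ → ℝ,
      (∀ l k, 0 < M l k) →
      (∀ l, ¬ BddAbove ((fun k : ℕ => M l k ^ (1 / (k : ℝ))) '' Set.Ici 1)) →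
      (∀ l₁ l₂, l₁ ≤ l₂ → ∀ k, M l₁ k ≤ M l₂ k) →
      ∃ ω : ℝ → ℝ,
        Ultradiff.IsSemiregularFunction ω ∧
        Ultradiff.IsAlmostSubadditive ω ∧
        (∀ (n : ℕ) (Ω : Set (EuclideanSpace ℝ (Fin n))), 1 ≤ n → IsOpen Ω →
          Ultradiff.IsQuasianalyticOn (Ultradiff.roumieuFunction ω Ω) Ω) ∧
        (∀ (n : ℕ) (Ω : Set (EuclideanSpace ℝ (Fin n))), 1 ≤ n → IsOpen Ω → Ω.Nonempty →
          ¬ Ultradiff.roumieuFunction ω Ω ⊆ Ultradiff.roumieuMatrix (Set.range M) Ω)) ∧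
    (∃ ω : ℝ → ℝ,
      Ultradiff.IsSemiregularFunction ω ∧
      Ultradiff.IsAlmostSubadditive ω ∧
      (∀ (n : ℕ) (Ω : Set (EuclideanSpace ℝ (Fin n))), 1 ≤ n → IsOpen Ω →
        Ultradiff.IsQuasianalyticOn (Ultradiff.roumieuFunction ω Ω) Ω) ∧
      (∀ M : ℕ → ℝ, Ultradiff.IsSemiregularSequence M →
        ∀ (n : ℕ) (Ω : Set (EuclideanSpace ℝ (Fin n))), 1 ≤ n → IsOpen Ω → Ω.Nonempty →
          ¬ Ultradiff.roumieuFunction ω Ω ⊆ Ultradiff.roumieuSequence M Ω)) := by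
  refine ⟨fun M hpos _ hmono => Ultradiff.exists_quasianalytic_not_subset M hpos hmono, ?_⟩
  obtain ⟨ω, h1, h2, h3, h4⟩ := Ultradiff.exists_quasianalytic_not_subset
    (fun l k => ((l : ℝ) + 1) ^ k ^ 2) (fun l k => by positivity)
    (fun l₁ l₂ h k => by gcongr)
  refine ⟨ω, h1, h2, h3, fun M hM n Ω hn hΩ hne hsub => ?_⟩
  obtain ⟨l, hl⟩ := hM.exists_le_pow_sq
  exact h4 n Ω hn hΩ hne (hsub.trans
    (Ultradiff.roumieuSequence_subset_roumieuMatrix (Set.mem_range_self l) hl Ω))
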